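/- A Robust Matroid Center instance consists of a finite metric space $(X,d)$, weights $w\colon X\to\mathbb{R}_{\ge 0}$, a matroid $M=(X,\mathcal{I})$ given by an independence oracle, and a number $m\in\mathbb{R}_{\ge 0}$. For $U\subseteq X$ and $\rho\ge 0$ let $B(U,\rho)=\{v\in X : d(u,v)\le\rho \text{ for some } u\in U\}$, $B(u,\rho)=B(\{u\},\rho)$ and $w(U)=\sum_{u\in U}w(u)$. A solution of radius $\rho$ is a set $C\in\mathcal{I}$ with $w(B(C,\rho))\ge m$. For $r\ge 0$ let $$\mathcal{J}=\{J\subseteq X : \text{there are } I\in\mathcal{I} \text{ and a bijection } \phi\colon J\to I \text{ with } d(\phi(e),e)\le 2r \text{ for all } e\in J\};$$ such a set $I$ is called a system of distinct representatives for $J$. Consider the following greedy algorithm. Start with $T=\emptyset$ and $U=X$. Repeat $\operatorname{rank}(M)$ times: choose a point $t\in X$ that maximizes $w(B(t,r)\cap U)$ among all $t\in X$ with $T\cup\{t\}\in\mathcal{J}$ (ties are broken arbitrarily, and $t \in T$ is allowed), then replace $T$ by $T\cup\{t\}$ and $U$ by $U\setminus B(t,3r)$. Finally return any system of distinct representatives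 $R$ for $T$. Theorem. (a) This algorithm is always well defined: in each iteration a maximizer exists, and the final set $T$ has a system of distinct representatives. Whenever the instance has a solution of radius $r$, every possible output $R$ of the algorithm, however the choices are made, is a solution of radius $5r$, that is, $R\in\mathcal{I}$ and $w(B(R,5r))\ge m$. (b) The algorithm can be implemented efficiently and combinatorially: there are a polynomial $p$ and a single deterministic random access machine program, which uses addition, subtraction and comparison of natural numbers, addition and comparison (and no other operations) of real numbers, and calls of the independence oracle of $M$, each at unit cost, such that for every instance and every $r\ge 0$ the program halts after at most $p(|X|)$ steps and returns a possible output $R$ of the algorithm above. In particular, if the instance has a solution of radius $r$, then the program returns a solution of radius $5r$. -/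

import Mathlib

open scoped NNReal

universe u

/-! ### Rado matroids -/

/-- `R` is a system of distinct representatives for `J` with respect to the matroid `M` on `X` and
the sets `N y ⊆ X`: `R` is independent in `M` and there is a bijection `φ : J → R` with
`φ y ∈ N y` for all `y ∈ J`. -/
def IsSDR {X Y : Type*} (M : Matroid X) (N : Y → Set X) (J : Set Y) (R : Set X) : Prop :=
  M.Indep R ∧ ∃ φ : J ≃ R, ∀ y : J, (φ y : X) ∈ N y

/-- Independence in the Rado matroid induced by `M` and the sets `N y`. -/
def RadoIndep {X Y : Type*} (M : Matroid X) (N : Y → Set X) (J : Set Y) : Prop :=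
  ∃ R : Set X, IsSDR M N J R

/-! ### Robust Matroid Center -/

/-- `B(U, r)`, the union of the closed balls of radius `r` around the points of `U`. -/
def cover {X : Type*} [MetricSpace X] (U : Set X) (r : ℝ≥0) : Set X :=
  ⋃ u ∈ U, Metric.closedBall u (r : ℝ)

/-- An instance of Robust Matroid Center on the finite metric space `X`: point weights `w`,
a matroid `M` with ground set `X`, and a lower bound `m` on the weight to be clustered. -/
structure RMCInstance (X : Type*) [Fintype X] [MetricSpace X] where
  w : X → ℝ≥0
  M : Matroid X
  ground_eq : M.E = Set.univ
  m : ℝ≥0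

namespace RMCInstance

variable {X : Type*} [Fintype X] [MetricSpace X]

/-- `w(S)`, the total weight of the points of `S`. -/
noncomputable def weight (P : RMCInstance X) (S : Set X) : ℝ≥0 :=
  ∑ x, S.indicator P.w x

/-- `C` is a solution of radius `r`. -/
def IsSolution (P : RMCInstance X) (r : ℝ≥0) (C : Set X) : Prop :=
  P.M.Indep C ∧ P.m ≤ P.weight (cover C r)

/-- The sets `X_e = B(e, 2r)` that define the relaxed matroid. -/
def nbhd (_P : RMCInstance X) (r : ℝ≥0) (e : X) : Set X := cover {e} (2 * r)

/-- Independence in the relaxed matroid, that is, in the Rado matroid induced by `M` and the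
balls of radius `2r`. -/
def RelaxIndep (P : RMCInstance X) (r : ℝ≥0) (J : Set X) : Prop :=
  RadoIndep P.M (P.nbhd r) J

/-- `t` is a legal greedy choice for the current centers `T` and the current uncovered points `U`:
it maximizes `w(B(t, r) ∩ U)` among all `t ∈ X` with `T ∪ {t}` independent in the relaxed
matroid. Ties may be broken in any way, and `t ∈ T` is not excluded. -/
def IsGreedyChoice (P : RMCInstance X) (r : ℝ≥0) (T U : Set X) (t : X) : Prop :=
  P.RelaxIndep r (T ∪ {t}) ∧
    ∀ t' : X, P.RelaxIndep r (T ∪ {t'}) →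
      P.weight (cover {t'} r ∩ U) ≤ P.weight (cover {t} r ∩ U)

/-- `P.GreedyRun r i T U`: some run of the greedy procedure has, after `i` iterations of its loop,
picked the set `T` of centers and left the set `U` of points uncovered. -/
inductive GreedyRun (P : RMCInstance X) (r : ℝ≥0) : ℕ → Set X → Set X → Prop
  | init : GreedyRun P r 0 ∅ Set.univ
  | step {i : ℕ} {T U : Set X} {t : X} : GreedyRun P r i T U → P.IsGreedyChoice r T U t →
      GreedyRun P r (i + 1) (T ∪ {t}) (U \ cover {t} (3 * r))

/-- The rank of the matroid of the instance. -/
noncomputable def rank (P : RMCInstance X) : ℕ := P.M.eRank.toNat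

/-- `R` is a possible output of the greedy algorithm with guess `r`: a system of distinct
representatives for a set `T` of centers that the greedy procedure can pick in `rank M`
iterations. -/
def IsGreedyOutput (P : RMCInstance X) (r : ℝ≥0) (R : Set X) : Prop :=
  ∃ T U : Set X, P.GreedyRun r P.rank T U ∧ IsSDR P.M (P.nbhd r) T R

end RMCInstance

/-! ### The machine model

Programs of a structured random access machine with an independence oracle. The memory consists
of arrays (named by natural numbers and indexed by pairs of natural numbers) of natural numbers and
of arrays of real numbers. Natural numbers may be added, subtracted and compared; real numbers may
only be added and compared, so no linear algebra or rounding is possible. Every assignment, every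
evaluation of a branching or loop condition, and every oracle call costs one step. (There is no
multiplication, so in `t` steps only numbers of bit length `O(t)` plus the input length arise, and
unit cost is a realistic measure.) -/

namespace OracleRAM

/-- The memory of the machine: `s.nat a i j` and `s.real a i j` are the cells with index `(i, j)`
of the arrays with name `a`. -/
structure State where
  nat : ℕ → ℕ → ℕ → ℕ
  real : ℕ → ℕ → ℕ → ℝ

/-- Expressions for natural numbers (`sub` is truncated subtraction). -/
inductive NatExpr where
  | const (c : ℕ)
  | read (a : ℕ) (i j : NatExpr)
  | add (x y : NatExpr)
  | sub (x y : NatExpr)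

/-- Expressions for real numbers. -/
inductive RealExpr where
  | zero
  | read (a : ℕ) (i j : NatExpr)
  | add (x y : RealExpr)

/-- Conditions. `indep a i` is a call of the oracle on the set `{j | s.nat a i j ≠ 0}` that is
stored in the `i`-th row of the array `a` of natural numbers. -/
inductive Test where
  | natLE (x y : NatExpr)
  | realLE (x y : RealExpr)
  | indep (a : ℕ) (i : NatExpr)

/-- Programs. -/
inductive Program where
  | nop
  | setNat (a : ℕ) (i j x : NatExpr)
  | setReal (a : ℕ) (i j : NatExpr) (x : RealExpr)
  | seq (p q : Program)
  | cond (b : Test) (p q : Program)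
  | loop (b : Test) (p : Program)

/-- The value of an expression for natural numbers. -/
def NatExpr.eval (s : State) : NatExpr → ℕ
  | .const c => c
  | .read a i j => s.nat a (i.eval s) (j.eval s)
  | .add x y => x.eval s + y.eval s
  | .sub x y => x.eval s - y.eval s

/-- The value of an expression for real numbers. -/
noncomputable def RealExpr.eval (s : State) : RealExpr → ℝ
  | .zero => 0
  | .read a i j => s.real a (i.eval s) (j.eval s)
  | .add x y => x.eval s + y.eval s

/-- The truth of a condition, for the oracle `O`. -/
def Test.Holds (O : Set ℕ → Prop) (s : State) : Test → Prop
  | .natLE x y => x.eval s ≤ y.eval s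
  | .realLE x y => x.eval s ≤ y.eval s
  | .indep a i => O {j | s.nat a (i.eval s) j ≠ 0}

/-- Write `v` to the cell `(i, j)` of the array `a` of natural numbers. -/
def State.writeNat (s : State) (a i j v : ℕ) : State where
  nat := fun a' i' j' => if a' = a ∧ i' = i ∧ j' = j then v else s.nat a' i' j'
  real := s.real

/-- Write `v` to the cell `(i, j)` of the array `a` of real numbers. -/
def State.writeReal (s : State) (a i j : ℕ) (v : ℝ) : State where
  nat := s.nat
  real := fun a' i' j' => if a' = a ∧ i' = i ∧ j' = j then v else s.real a' i' j'

/-- `Exec O p s s' k`: with oracle `O`, the program `p` started in the state `s` halts after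
exactly `k` steps in the state `s'`. -/
inductive Exec (O : Set ℕ → Prop) : Program → State → State → ℕ → Prop
  | nop (s : State) : Exec O .nop s s 1
  | setNat (s : State) (a : ℕ) (i j x : NatExpr) :
      Exec O (.setNat a i j x) s (s.writeNat a (i.eval s) (j.eval s) (x.eval s)) 1
  | setReal (s : State) (a : ℕ) (i j : NatExpr) (x : RealExpr) :
      Exec O (.setReal a i j x) s (s.writeReal a (i.eval s) (j.eval s) (x.eval s)) 1
  | seq {p q : Program} {s s' s'' : State} {k l : ℕ} :
      Exec O p s s' k → Exec O q s' s'' l → Exec O (.seq p q) s s'' (k + l)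
  | cond_true {b : Test} {p q : Program} {s s' : State} {k : ℕ} :
      b.Holds O s → Exec O p s s' k → Exec O (.cond b p q) s s' (k + 1)
  | cond_false {b : Test} {p q : Program} {s s' : State} {k : ℕ} :
      ¬ b.Holds O s → Exec O q s s' k → Exec O (.cond b p q) s s' (k + 1)
  | loop_true {b : Test} {p : Program} {s s' s'' : State} {k l : ℕ} :
      b.Holds O s → Exec O p s s' k → Exec O (.loop b p) s' s'' l →
        Exec O (.loop b p) s s'' (k + l + 1)
  | loop_false {b : Test} {p : Program} {s : State} :
      ¬ b.Holds O s → Exec O (.loop b p) s s 1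

/-- The machine is deterministic: the final state and the number of steps are unique. -/
theorem Exec.unique {O : Set ℕ → Prop} {p : Program} {s s₁ : State} {k₁ : ℕ}
    (h₁ : Exec O p s s₁ k₁) : ∀ {s₂ : State} {k₂ : ℕ}, Exec O p s s₂ k₂ → s₁ = s₂ ∧ k₁ = k₂ := by
  induction h₁ with
  | nop s => intro s₂ k₂ h; cases h; exact ⟨rfl, rfl⟩
  | setNat s a i j x => intro s₂ k₂ h; cases h; exact ⟨rfl, rfl⟩
  | setReal s a i j x => intro s₂ k₂ h; cases h; exact ⟨rfl, rfl⟩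
  | seq _ _ ih₁ ih₂ =>
    intro s₂ k₂ h
    cases h with
    | seq h h' =>
      obtain ⟨rfl, rfl⟩ := ih₁ h
      obtain ⟨rfl, rfl⟩ := ih₂ h'
      exact ⟨rfl, rfl⟩
  | cond_true hb _ ih =>
    intro s₂ k₂ h
    cases h with
    | cond_true _ h => obtain ⟨rfl, rfl⟩ := ih h; exact ⟨rfl, rfl⟩
    | cond_false hb' _ => exact absurd hb hb'
  | cond_false hb _ ih =>
    intro s₂ k₂ h
    cases h with
    | cond_true hb' _ => exact absurd hb' hb
    | cond_false _ h => obtain ⟨rfl, rfl⟩ := ih h; exact ⟨rfl, rfl⟩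
  | loop_true hb _ _ ih₁ ih₂ =>
    intro s₂ k₂ h
    cases h with
    | loop_true _ h h' =>
      obtain ⟨rfl, rfl⟩ := ih₁ h
      obtain ⟨rfl, rfl⟩ := ih₂ h'
      exact ⟨rfl, rfl⟩
    | loop_false hb' => exact absurd hb hb'
  | loop_false hb =>
    intro s₂ k₂ h
    cases h with
    | loop_true hb' _ _ => exact absurd hb' hb
    | loop_false _ => exact ⟨rfl, rfl⟩

end OracleRAM

/-! ### Instances as inputs of the machine

The points of `X` are numbered by `e : Fin (Fintype.card X) ≃ X`. -/

namespace RMCInstance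

variable {X : Type*} [Fintype X] [MetricSpace X]

/-- The independence oracle of the matroid, on sets of point numbers (numbers that are not
numbers of points are ignored). -/
def oracle (P : RMCInstance X) (e : Fin (Fintype.card X) ≃ X) (S : Set ℕ) : Prop :=
  P.M.Indep {x | ((e.symm x : Fin (Fintype.card X)) : ℕ) ∈ S}

/-- The initial memory: the number of points is in cell `(0, 0)` of array `0` of natural numbers;
real array `0` is the distance matrix, row `0` of real array `1` holds the weights, and the cells
`(0, 0)` of the real arrays `2` and `3` hold `m` and the guess `r`. All other cells are zero. -/
noncomputable def input (P : RMCInstance X) (r : ℝ≥0) (e : Fin (Fintype.card X) ≃ X) :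
    OracleRAM.State where
  nat := fun a i j => if a = 0 ∧ i = 0 ∧ j = 0 then Fintype.card X else 0
  real := fun a i j =>
    if a = 0 then
      if h : i < Fintype.card X ∧ j < Fintype.card X then dist (e ⟨i, h.1⟩) (e ⟨j, h.2⟩) else 0
    else if a = 1 ∧ i = 0 then
      if h : j < Fintype.card X then (P.w (e ⟨j, h⟩) : ℝ) else 0
    else if a = 2 ∧ i = 0 ∧ j = 0 then (P.m : ℝ)
    else if a = 3 ∧ i = 0 ∧ j = 0 then (r : ℝ)
    else 0

end RMCInstance

/-- The set of points that a final memory encodes: those whose number is marked by a nonzero entry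
in row `0` of array `1` of natural numbers. -/
def OracleRAM.State.output {X : Type*} [Fintype X] (s : OracleRAM.State)
    (e : Fin (Fintype.card X) ≃ X) : Set X :=
  {x | s.nat 1 0 (e.symm x : Fin (Fintype.card X)) ≠ 0}

/-! ### Rado matroids: augmenting paths -/

/-! Both halves of the theorem rest on the Rado matroid: sets `J` whose members have distinct
representatives, chosen from the given neighbourhoods, that together are independent in `M`. Its
augmentation property is proved by augmenting paths. One follows exchange steps from the element to
be added until some reached element has a neighbour outside the span of the current representatives.
Performing only the last exchange of such a path leaves another path that avoids the vertex just
changed (`Represents.swap`), so no shortest paths are needed and repetition ends. If there is no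
path, the reachable set has one element more than the representatives that span all its
neighbourhoods, hence is dependent (`Represents.exists_certificate`). Uniting such certificates
yields `RadoIndep.exists_insert`.

For the approximation guarantee, fix a solution `C` of radius `r`. `GreedyRun.weight_cover_le`
maintains a remainder `C'` of `C` that is independent jointly with representatives of `T`, such that
covered weight plus the uncovered weight near `C'` still accounts for all that `C` covers. If a new
center `t` is within `2r` of some `c` in `C'`, then `c` becomes its representative and the `3r`-ball
of `t` absorbs the ball of `c`. If `t` is far from `C'`, then `exists_exchange` sacrifices at most
one `c`; the greedy choice makes the gain at `t` at least the loss at `c`, and the gain is disjoint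
from the balls around `C'`. If an old center is picked again, nothing around `C'` is left to gain.
After `rank M` rounds there is no room for `C'`, so the `3r`-balls around `T` suffice.
Representatives are at distance at most `2r`, whence `5r`.

For the machine, the same path search runs with oracle calls as span tests. The program is written
in a language of bounded loops (`Cmd`), where termination and a polynomial cost bound come from the
syntax (`Cmd.exec_compile`); correctness is then shown by loop invariants for a total semantics,
ending in `run_main`. -/

section Rado

open Set

variable {X Y : Type*} {M : Matroid X} {N : Y → Set X} {T D J : Set Y} {R : Set X}
  {φ : Y → X} {t y z : Y} {x : X}

/-- The map `φ` restricts to a bijection from `T` to a system of distinct representatives. -/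
structure Represents (M : Matroid X) (N : Y → Set X) (T : Set Y) (φ : Y → X) : Prop where
  injOn : InjOn φ T
  indep : M.Indep (φ '' T)
  mem : ∀ y ∈ T, φ y ∈ N y

theorem Represents.isSDR (h : Represents M N T φ) : IsSDR M N T (φ '' T) :=
  ⟨h.indep, Equiv.Set.imageOfInjOn φ T h.injOn, fun y => h.mem y y.2⟩

theorem Represents.radoIndep (h : Represents M N T φ) : RadoIndep M N T := ⟨_, h.isSDR⟩

theorem Represents.mono (h : Represents M N T φ) (hJ : J ⊆ T) : Represents M N J φ :=
  ⟨h.injOn.mono hJ, h.indep.subset (image_mono hJ), fun y hy => h.mem y (hJ hy)⟩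

/-- A total function, arbitrary off `J`, replaces the bijection of subtypes, so that representatives
can later be changed by `Function.update`. -/
theorem IsSDR.exists_represents [Nonempty X] (h : IsSDR M N J R) :
    ∃ φ, Represents M N J φ ∧ φ '' J = R := by
  classical
  obtain ⟨hR, f, hf⟩ := h
  have key : ∀ (y : Y) (hy : y ∈ J),
      (if h : y ∈ J then (f ⟨y, h⟩ : X) else Classical.arbitrary X) = f ⟨y, hy⟩ :=
    fun y hy => dif_pos hy
  have himg : (fun y => if h : y ∈ J then (f ⟨y, h⟩ : X) else Classical.arbitrary X) '' J = R := by
    ext x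
    constructor
    · rintro ⟨y, hy, rfl⟩
      simp only [key y hy, Subtype.coe_prop]
    · intro hx
      refine ⟨f.symm ⟨x, hx⟩, (f.symm ⟨x, hx⟩).2, ?_⟩
      simp
  refine ⟨_, ⟨fun y hy y' hy' h => ?_, by rwa [himg], fun y hy => ?_⟩, himg⟩
  · simp only [key y hy, key y' hy'] at h
    simpa using f.injective (Subtype.ext h)
  · simp only [key y hy]
    exact hf ⟨y, hy⟩

theorem RadoIndep.exists_represents [Nonempty X] (h : RadoIndep M N J) :
    ∃ φ, Represents M N J φ := by
  obtain ⟨R, hR⟩ := h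
  obtain ⟨φ, hφ, -⟩ := hR.exists_represents
  exact ⟨φ, hφ⟩

/-- The exchange step from `y` to `z`: `y` may take over the representative of `z` via some
neighbour `x` of `y`. Elements of `D` must not be used. -/
def ExchangeStep (M : Matroid X) (N : Y → Set X) (T D : Set Y) (φ : Y → X) (y z : Y) : Prop :=
  z ∈ T ∧ z ∉ D ∧ ∃ x ∈ N y, x ∈ M.closure (φ '' T) ∧ x ∉ M.closure (φ '' (T \ {z}))

/-- `z` can be reached from `t` by exchange steps that avoid `D`. -/
def ExchangeReach (M : Matroid X) (N : Y → Set X) (T D : Set Y) (φ : Y → X) (t z : Y) : Prop :=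
  Relation.ReflTransGen (ExchangeStep M N T D φ) t z

/-- There is an augmenting path that starts in `t` and avoids `D`. -/
def Augmentable (M : Matroid X) (N : Y → Set X) (T D : Set Y) (φ : Y → X) (t : Y) : Prop :=
  ∃ y, ExchangeReach M N T D φ t y ∧ ∃ x ∈ N y, x ∉ M.closure (φ '' T)

theorem ExchangeReach.eq_or_mem (h : ExchangeReach M N T D φ t y) : y = t ∨ (y ∈ T ∧ y ∉ D) := by
  cases h with
  | refl => exact .inl rfl
  | tail _ h => exact .inr ⟨h.1, h.2.1⟩

theorem Matroid.notMem_of_closure (hE : M.E = univ) {S : Set X} (hx : x ∉ M.closure S) : x ∉ S :=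
  fun h => hx (M.subset_closure S (by rw [hE]; exact subset_univ _) h)

theorem insert_indep_of_notMem_closure (hE : M.E = univ) {S : Set X} (hS : M.Indep S)
    (hx : x ∉ M.closure S) : M.Indep (insert x S) :=
  ((hS.notMem_closure_iff (by rw [hE]; trivial)).1 hx).1

theorem image_update_diff [DecidableEq Y] {S : Set Y} (hy : y ∈ S) :
    Function.update φ y x '' S = insert x (φ '' (S \ {y})) := by
  ext w
  constructor
  · rintro ⟨z, hz, rfl⟩
    by_cases h : z = y
    · subst h; simp
    · exact .inr ⟨z, ⟨hz, h⟩, by simp [h]⟩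
  · rintro (rfl | ⟨z, ⟨hz, hzy⟩, rfl⟩)
    · exact ⟨y, hy, by simp⟩
    · exact ⟨z, hz, by rw [Function.update_of_ne hzy]⟩

/-- Removing `y` first lets one statement serve two purposes: for `y ∈ T` it exchanges a
representative, for `y ∉ T` it adds a new element. -/
theorem Represents.update [DecidableEq Y] (hE : M.E = univ) (h : Represents M N (T \ {y}) φ)
    (hxN : x ∈ N y) (hx : x ∉ M.closure (φ '' (T \ {y}))) :
    Represents M N (insert y T) (Function.update φ y x) := by
  have hnot := Matroid.notMem_of_closure hE hx
  have hupd : ∀ z, z ≠ y → Function.update φ y x z = φ z := fun z hz => Function.update_of_ne hz _ _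
  refine ⟨?_, ?_, ?_⟩
  · intro a ha b hb hab
    by_cases hay : a = y <;> by_cases hby : b = y
    · rw [hay, hby]
    · rw [hay, Function.update_self, hupd b hby] at hab
      exact absurd ⟨b, ⟨hb.resolve_left hby, hby⟩, hab.symm⟩ hnot
    · rw [hby, Function.update_self, hupd a hay] at hab
      exact absurd ⟨a, ⟨ha.resolve_left hay, hay⟩, hab⟩ hnot
    · rw [hupd a hay, hupd b hby] at hab
      exact h.injOn ⟨ha.resolve_left hay, hay⟩ ⟨hb.resolve_left hby, hby⟩ hab
  · rw [image_update_diff (mem_insert y T), insert_sdiff_of_mem _ (mem_singleton y)]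
    exact insert_indep_of_notMem_closure hE h.indep hx
  · intro z hz
    by_cases hzy : z = y
    · subst hzy; simpa using hxN
    · rw [hupd z hzy]
      exact h.mem z ⟨hz.resolve_left hzy, hzy⟩

/-- Performing the last exchange of an augmenting path leaves an augmenting path that does not
use the last vertex any more. -/
theorem Represents.swap [DecidableEq Y] (hE : M.E = univ) (h : Represents M N T φ)
    (hr : ExchangeReach M N T D φ t y) (hyt : y ≠ t) (hxN : x ∈ N y)
    (hx : x ∉ M.closure (φ '' T)) :
    Represents M N T (Function.update φ y x) ∧
      Augmentable M N T (insert y D) (Function.update φ y x) t := by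
  have hyT : y ∈ T := (hr.eq_or_mem.resolve_left hyt).1
  set ψ := Function.update φ y x with hψ
  have hsub : M.closure (φ '' (T \ {y})) ⊆ M.closure (φ '' T) :=
    M.closure_subset_closure (image_mono sdiff_subset)
  refine ⟨?_, ?_⟩
  · have := (h.mono sdiff_subset).update hE hxN (fun h' => hx (hsub h'))
    rwa [insert_eq_of_mem hyT] at this
  have himg : ψ '' T = insert x (φ '' (T \ {y})) := image_update_diff hyT
  -- a point in both spans lies in the span without the moved element
  have hexch : ∀ (S : Set Y) (w : X), S ⊆ T → w ∈ M.closure (insert x (φ '' S)) →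
      w ∈ M.closure (φ '' T) → w ∈ M.closure (φ '' S) := by
    intro S w hS hw hwT
    by_contra hcon
    -- Otherwise the exchange property puts `x` into the span of `w` and `φ '' S`, hence of `φ ''
    -- T`, against the choice of `x`.
    have h1 := (M.closure_exchange ⟨hw, hcon⟩).1
    refine hx (?_ : x ∈ M.closure (φ '' T))
    rw [← M.closure_closure (φ '' T)]
    refine M.closure_subset_closure ?_ h1
    rintro _ (rfl | hv)
    · exact hwT
    · exact M.closure_subset_closure (image_mono hS) (M.subset_closure _
        (by rw [hE]; exact subset_univ _) hv)
  -- Without an augmenting path after the swap, every point reachable before stays reachable. This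
  -- includes `y`, which is now forbidden and differs from `t`.
  by_contra hnone
  have hclosed : ∀ y', ExchangeReach M N T (insert y D) ψ t y' → ∀ w ∈ N y',
      w ∈ M.closure (ψ '' T) := by
    intro y' hy' w hw
    by_contra hc
    exact hnone ⟨y', hy', w, hw, hc⟩
  have hall : ∀ y', ExchangeReach M N T D φ t y' → ExchangeReach M N T (insert y D) ψ t y' := by
    intro y' hy'
    induction hy' with
    | refl => exact .refl
    | @tail a z _ hs ih =>
      obtain ⟨hzT, hzD, w, hwN, hwT, hwz⟩ := hs
      have hwψ := hclosed a ih w hwN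
      have hwy : w ∈ M.closure (φ '' (T \ {y})) := hexch _ w sdiff_subset (himg ▸ hwψ) hwT
      have hzy : z ≠ y := by rintro rfl; exact hwz hwy
      refine ih.tail ⟨hzT, by simp [hzy, hzD], w, hwN, hwψ, fun hcon => hwz ?_⟩
      rw [image_update_diff (show y ∈ T \ {z} from ⟨hyT, hzy.symm⟩)] at hcon
      have := hexch ((T \ {z}) \ {y}) w (sdiff_subset.trans sdiff_subset) hcon hwT
      exact M.closure_subset_closure (image_mono sdiff_subset) this
  rcases (hall y hr).eq_or_mem with h' | h'
  · exact hyt h'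
  · exact h'.2 (mem_insert _ _)

/-- If there is no augmenting path, then the reachable set certifies dependence. -/
theorem Represents.exists_certificate (h : Represents M N T φ)
    (hno : ¬ Augmentable M N T ∅ φ t) :
    ∃ V : Set Y, t ∈ V ∧ V ⊆ insert t T ∧ ∀ y ∈ V, N y ⊆ M.closure (φ '' (V ∩ T)) := by
  set V := {y | ExchangeReach M N T ∅ φ t y} with hV
  refine ⟨V, .refl, fun y hy => ?_, fun y hy x hx => ?_⟩
  · rcases ExchangeReach.eq_or_mem hy with rfl | h'
    · simp
    · exact .inr h'.1
  have hxT : x ∈ M.closure (φ '' T) := by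
    by_contra hc
    exact hno ⟨y, hy, x, hx, hc⟩
  -- Closure commutes with intersections of subsets of one independent set. The index `none` keeps
  -- the family nonempty when `T \ V` is empty; the intersection leaves only representatives of `V ∩
  -- T`.
  let Js : Option ↑(T \ V) → Set X := fun o => o.elim (φ '' T) fun z => φ '' (T \ {z.1})
  have hJs : ∀ o, Js o ⊆ φ '' T := by
    rintro (_ | z)
    · exact subset_rfl
    · exact image_mono sdiff_subset
  have hmem : x ∈ M.closure (⋂ o, Js o) := by
    rw [h.indep.closure_iInter_eq_biInter_closure_of_forall_subset hJs, mem_iInter]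
    rintro (_ | ⟨z, hz⟩)
    · exact hxT
    · by_contra hc
      exact hz.2 (Relation.ReflTransGen.tail hy ⟨hz.1, by simp, x, hx, hxT, hc⟩)
  refine M.closure_subset_closure (fun w hw => ?_) hmem
  rw [mem_iInter] at hw
  obtain ⟨z, hzT, rfl⟩ := hw none
  refine ⟨z, ⟨?_, hzT⟩, rfl⟩
  by_contra hzV
  obtain ⟨z', hz', heq⟩ := hw (some ⟨z, hzT, hzV⟩)
  exact hz'.2 (h.injOn hz'.1 hzT heq)

/-- The representatives of `J ∩ V` are independent and lie in the span of `S`, so the rank of `S`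
bounds their number. This is the easy direction of Rado's theorem. -/
theorem Represents.encard_inter_le {V : Set Y} {S : Set X} (h : Represents M N J φ)
    (hV : ∀ y ∈ V, N y ⊆ M.closure S) : (J ∩ V).encard ≤ S.encard := by
  have h1 : φ '' (J ∩ V) ⊆ M.closure S := by
    rintro _ ⟨y, hy, rfl⟩
    exact hV y hy.2 (h.mem y hy.1)
  calc (J ∩ V).encard = (φ '' (J ∩ V)).encard :=
        ((h.injOn.mono inter_subset_left).encard_image).symm
    _ = M.eRk (φ '' (J ∩ V)) :=
        ((h.indep.subset (image_mono inter_subset_left)).eRk_eq_encard).symm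
    _ ≤ M.eRk (M.closure S) := M.eRk_mono h1
    _ = M.eRk S := M.eRk_closure_eq S
    _ ≤ S.encard := M.eRk_le_encard S

/-- The certificate `V` contains `t`, so it has one element more than `V ∩ T`, whose representatives
span every neighbourhood of `V`. -/
theorem Represents.not_radoIndep_insert [Finite Y] (h : Represents M N T φ)
    (ht : t ∉ T) (hno : ¬ Augmentable M N T ∅ φ t) : ¬ RadoIndep M N (insert t T) := by
  intro hJ
  have : Nonempty X := ⟨φ t⟩
  obtain ⟨ψ, hψ⟩ := hJ.exists_represents
  obtain ⟨V, htV, hVT, hV⟩ := h.exists_certificate hno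
  have h1 := hψ.encard_inter_le hV
  rw [inter_eq_right.2 hVT, (h.injOn.mono inter_subset_right).encard_image] at h1
  have h2 : V = insert t (V ∩ T) := by
    ext y
    constructor
    · intro hy
      rcases hVT hy with rfl | h'
      · simp
      · exact .inr ⟨hy, h'⟩
    · rintro (rfl | h')
      · exact htV
      · exact h'.1
  rw [h2, encard_insert_of_notMem (fun h' => ht h'.2), ← h2] at h1
  have h3 : (V ∩ T).encard ≠ ⊤ := (Set.toFinite (V ∩ T)).encard_lt_top.ne
  exact absurd h1 (not_le.2 (ENat.lt_add_one_iff h3 |>.2 le_rfl))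

/-- Each swap moves one more element of `T` into `D`, so `T \ D` shrinks until the free point found
is a neighbour of `t` itself. -/
theorem Represents.insert_of_augmentable [Finite Y] (hE : M.E = univ)
    (h : Represents M N T φ) (ht : t ∉ T) (haug : Augmentable M N T D φ t) :
    RadoIndep M N (insert t T) := by
  classical
  induction hk : (T \ D).ncard using Nat.strong_induction_on generalizing D φ with
  | _ k ih =>
    obtain ⟨y, hy, x, hxN, hx⟩ := haug
    by_cases hyt : y = t
    · subst hyt
      refine (Represents.update hE (h.mono sdiff_subset) hxN fun hc => hx ?_).radoIndep
      exact M.closure_subset_closure (image_mono sdiff_subset) hc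
    · obtain ⟨h1, h2⟩ := h.swap hE hy hyt hxN hx
      refine ih _ ?_ h1 h2 rfl
      rw [← hk]
      have hyT := hy.eq_or_mem.resolve_left hyt
      refine ncard_lt_ncard ⟨sdiff_subset_sdiff_right (subset_insert _ _), fun hc => ?_⟩
        (Set.toFinite _)
      exact (hc hyT).2 (mem_insert _ _)

/-- The augmentation property of Rado matroids. -/
theorem RadoIndep.exists_insert [Finite Y] (hE : M.E = univ) {J₁ J₂ : Set Y}
    (h₁ : RadoIndep M N J₁) (h₂ : RadoIndep M N J₂) (hlt : J₁.ncard < J₂.ncard) :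
    ∃ y ∈ J₂, y ∉ J₁ ∧ RadoIndep M N (insert y J₁) := by
  by_contra! hcon
  have hX : Nonempty X := by
    obtain ⟨y, hy⟩ := nonempty_of_ncard_ne_zero (Nat.ne_of_gt (Nat.zero_lt_of_lt hlt))
    obtain ⟨R, -, f, -⟩ := h₂
    exact ⟨f ⟨y, hy⟩⟩
  obtain ⟨φ, hφ⟩ := h₁.exists_represents
  obtain ⟨ψ, hψ⟩ := h₂.exists_represents
  have hV : ∀ y : Y, y ∈ J₂ \ J₁ → ∃ V : Set Y, y ∈ V ∧ V ⊆ insert y J₁ ∧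
      ∀ z ∈ V, N z ⊆ M.closure (φ '' (V ∩ J₁)) := fun y hy =>
    hφ.exists_certificate fun haug => hcon y hy.1 hy.2 (hφ.insert_of_augmentable hE hy.2 haug)
  choose! V hV₁ hV₂ hV₃ using hV
  -- A union of certificates is a certificate. Inside `W` rank counting shows that `J₂` is no larger
  -- than `J₁`; outside `W` it is contained in `J₁`.
  set W := ⋃ y ∈ J₂ \ J₁, V y with hW
  have hWcl : ∀ z ∈ W, N z ⊆ M.closure (φ '' (W ∩ J₁)) := by
    intro z hz
    obtain ⟨y, hy, hzy⟩ := mem_iUnion₂.1 hz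
    refine (hV₃ y hy z hzy).trans (M.closure_subset_closure (image_mono ?_))
    exact inter_subset_inter_left _ (subset_biUnion_of_mem (u := V) hy)
  have h1 := hψ.encard_inter_le hWcl
  rw [(hφ.injOn.mono inter_subset_right).encard_image,
    ← (Set.toFinite _).cast_ncard_eq, ← (Set.toFinite _).cast_ncard_eq, Nat.cast_le] at h1
  have h2 : (J₂ \ W).ncard ≤ (J₁ \ W).ncard := by
    refine ncard_le_ncard (fun y hy => ⟨?_, hy.2⟩) (Set.toFinite _)
    by_contra hy1
    exact hy.2 (mem_iUnion₂.2 ⟨y, ⟨hy.1, hy1⟩, hV₁ y ⟨hy.1, hy1⟩⟩)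
  have h3 := ncard_inter_add_ncard_sdiff_eq_ncard J₂ W (Set.toFinite _)
  have h4 := ncard_inter_add_ncard_sdiff_eq_ncard J₁ W (Set.toFinite _)
  rw [inter_comm J₁ W] at h4
  omega

/-- An independent set extends inside the union with a larger one. -/
theorem RadoIndep.exists_extension [Finite Y] (hE : M.E = univ) {J₁ J₂ : Set Y}
    (h₁ : RadoIndep M N J₁) (h₂ : RadoIndep M N J₂) :
    ∃ K, J₁ ⊆ K ∧ K ⊆ J₁ ∪ J₂ ∧ RadoIndep M N K ∧ J₂.ncard ≤ K.ncard := by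
  obtain ⟨K, ⟨hK₁, hK₂, hK₃⟩, hmax⟩ := Set.exists_max_image
    {K | J₁ ⊆ K ∧ K ⊆ J₁ ∪ J₂ ∧ RadoIndep M N K} ncard (Set.toFinite _)
    ⟨J₁, subset_rfl, subset_union_left, h₁⟩
  refine ⟨K, hK₁, hK₂, hK₃, ?_⟩
  by_contra! hlt
  obtain ⟨y, hy, hyK, hind⟩ := hK₃.exists_insert hE h₂ hlt
  have := hmax (insert y K) ⟨hK₁.trans (subset_insert _ _),
    insert_subset (.inr hy) hK₂, hind⟩
  rw [ncard_insert_of_notMem hyK (Set.toFinite _)] at this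
  omega

end Rado

/-! ### The greedy algorithm -/

section Greedy

open Set

section Cover

variable {X : Type*} [MetricSpace X]

theorem mem_cover {U : Set X} {ρ : ℝ≥0} {x : X} : x ∈ cover U ρ ↔ ∃ u ∈ U, dist x u ≤ ρ := by
  simp [cover]

theorem mem_cover_singleton {u : X} {ρ : ℝ≥0} {x : X} : x ∈ cover {u} ρ ↔ dist x u ≤ ρ := by
  simp [cover]

theorem cover_union (U V : Set X) (ρ : ℝ≥0) : cover (U ∪ V) ρ = cover U ρ ∪ cover V ρ :=
  biUnion_union U V _

end Cover

namespace RMCInstance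

variable {X : Type*} [Fintype X] [MetricSpace X] {P : RMCInstance X} {r : ℝ≥0}
  {i : ℕ} {T U C : Set X} {t : X}

theorem weight_mono {S S' : Set X} (h : S ⊆ S') : P.weight S ≤ P.weight S' :=
  Finset.sum_le_sum fun x _ => indicator_le_indicator_of_subset h (fun _ => zero_le) x

theorem weight_union_of_disjoint {S S' : Set X} (h : Disjoint S S') :
    P.weight (S ∪ S') = P.weight S + P.weight S' := by
  simp only [weight, indicator_union_of_disjoint h, Finset.sum_add_distrib]

theorem weight_union_le (S S' : Set X) : P.weight (S ∪ S') ≤ P.weight S + P.weight S' := by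
  rw [← union_sdiff_self, weight_union_of_disjoint disjoint_sdiff_right]
  exact add_le_add_right (weight_mono sdiff_subset) _

theorem weight_empty : P.weight ∅ = 0 := by simp [weight]

theorem weight_eq_zero {S : Set X} : P.weight S = 0 ↔ ∀ x ∈ S, P.w x = 0 := by
  simp only [weight, Finset.sum_eq_zero_iff, Finset.mem_univ, true_implies]
  refine forall_congr' fun x => ?_
  by_cases h : x ∈ S <;> simp [h]

theorem ncard_le_rank {I : Set X} (h : P.M.Indep I) : I.ncard ≤ P.rank := by
  have h1 := h.encard_le_eRank
  obtain ⟨B, hB⟩ := P.M.exists_isBase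
  have h2 : P.M.eRank ≠ ⊤ := by
    rw [← hB.encard_eq_eRank]
    exact (toFinite B).encard_lt_top.ne
  exact ENat.toNat_le_toNat h1 h2

theorem mem_nbhd {x y : X} : x ∈ P.nbhd r y ↔ dist x y ≤ 2 * r := by
  simp [nbhd, cover]

theorem represents_id (h : P.M.Indep C) : Represents P.M (P.nbhd r) C id :=
  ⟨injOn_id C, by simpa using h, fun y _ => mem_nbhd.2 (by simp)⟩

theorem GreedyRun.relaxIndep (h : P.GreedyRun r i T U) : P.RelaxIndep r T := by
  cases h with
  | init => exact (represents_id P.M.empty_indep).radoIndep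
  | step _ ht => exact ht.1

theorem GreedyRun.uncovered_eq (h : P.GreedyRun r i T U) : U = (cover T (3 * r))ᶜ := by
  induction h with
  | init => simp [cover]
  | step _ _ ih => rw [ih, cover_union, compl_union]; rfl

/-- A nonempty `T` always admits one of its own elements again. Only for empty `T` is positive rank
needed, to provide a nonloop. -/
theorem GreedyRun.exists_choice (h : P.GreedyRun r i T U) (hi : i < P.rank) :
    ∃ t : X, P.IsGreedyChoice r T U t := by
  have hne : ∃ t, P.RelaxIndep r (T ∪ {t}) := by
    rcases T.eq_empty_or_nonempty with rfl | ⟨t, ht⟩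
    · obtain ⟨B, hB⟩ := P.M.exists_isBase
      have : B.Nonempty := by
        rw [nonempty_iff_ne_empty]
        rintro rfl
        have h0 := hB.encard_eq_eRank
        rw [encard_empty] at h0
        rw [rank, ← h0] at hi
        simp at hi
      obtain ⟨t, ht⟩ := this
      refine ⟨t, (represents_id (hB.indep.subset ?_)).radoIndep⟩
      simpa using ht
    · refine ⟨t, ?_⟩
      rw [union_eq_self_of_subset_right (singleton_subset_iff.2 ht)]
      exact h.relaxIndep
  obtain ⟨t, ht, hmax⟩ := exists_max_image {t | P.RelaxIndep r (T ∪ {t})}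
    (fun t => P.weight (cover {t} r ∩ U)) (toFinite _) hne
  exact ⟨t, ht, hmax⟩

/-- If `I` represents `T` and `I ∪ C` is independent, then adding `t` to `T` costs at most one
element of `C`. -/
theorem exists_exchange {φ : X → X} (hφ : Represents P.M (P.nbhd r) T φ)
    (hdisj : Disjoint (φ '' T) C) (hind : P.M.Indep (φ '' T ∪ C))
    (ht : P.RelaxIndep r (T ∪ {t})) :
    ∃ (ψ : X → X) (C' : Set X), C' ⊆ C ∧ Represents P.M (P.nbhd r) (T ∪ {t}) ψ ∧
      Disjoint (ψ '' (T ∪ {t})) C' ∧ P.M.Indep (ψ '' (T ∪ {t}) ∪ C') ∧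
      (C \ C').Subsingleton := by
  have : Nonempty X := ⟨t⟩
  obtain ⟨φ₁, hφ₁⟩ := ht.exists_represents
  -- Centers live in the left copy, with balls as neighbourhoods; elements of `C` live in the right
  -- copy and can only represent themselves. Extending the left set `T ∪ {t}` towards the joint set
  -- then re-chooses the representatives of the centers while keeping the surviving part of `C`
  -- fixed.
  let N : X ⊕ X → Set X := Sum.elim (P.nbhd r) (fun c => {c})
  have h₁ : RadoIndep P.M N (Sum.inl '' (T ∪ {t})) := by
    refine Represents.radoIndep (φ := Sum.elim φ₁ id) ⟨?_, ?_, ?_⟩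
    · rintro _ ⟨a, ha, rfl⟩ _ ⟨b, hb, rfl⟩ hab
      exact congrArg _ (hφ₁.injOn ha hb hab)
    · rw [image_image]
      exact hφ₁.indep
    · rintro _ ⟨a, ha, rfl⟩
      exact hφ₁.mem a ha
  have h₂ : RadoIndep P.M N (Sum.inl '' T ∪ Sum.inr '' C) := by
    refine Represents.radoIndep (φ := Sum.elim φ id) ⟨?_, ?_, ?_⟩
    · rintro _ (⟨a, ha, rfl⟩ | ⟨a, ha, rfl⟩) _ (⟨b, hb, rfl⟩ | ⟨b, hb, rfl⟩) hab
      · exact congrArg _ (hφ.injOn ha hb hab)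
      · exact (disjoint_left.1 hdisj ⟨a, ha, hab⟩ hb).elim
      · exact (disjoint_left.1 hdisj ⟨b, hb, hab.symm⟩ ha).elim
      · exact congrArg _ hab
    · rw [image_union, image_image, image_image]
      simpa using hind
    · rintro _ (⟨a, ha, rfl⟩ | ⟨a, ha, rfl⟩)
      · exact hφ.mem a ha
      · rfl
  obtain ⟨K, hK₁, hK₂, hK, hcard⟩ := h₁.exists_extension P.ground_eq h₂
  obtain ⟨χ, hχ⟩ := hK.exists_represents
  have hinr : ∀ c, Sum.inr c ∈ K → χ (Sum.inr c) = c := fun c hc => hχ.mem _ hc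
  have hinl : ∀ a ∈ T ∪ {t}, (Sum.inl a : X ⊕ X) ∈ K := fun a ha => hK₁ ⟨a, ha, rfl⟩
  refine ⟨χ ∘ Sum.inl, Sum.inr ⁻¹' K, ?_, ⟨?_, ?_, ?_⟩, ?_, ?_, ?_⟩
  · intro c hc
    rcases hK₂ hc with ⟨a, _, h⟩ | ⟨a, _, h⟩ | ⟨a, ha, h⟩
    · cases h
    · cases h
    · cases h; exact ha
  · intro a ha b hb hab
    exact Sum.inl_injective (hχ.injOn (hinl a ha) (hinl b hb) hab)
  · refine hχ.indep.subset ?_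
    rintro _ ⟨a, ha, rfl⟩
    exact ⟨_, hinl a ha, rfl⟩
  · intro a ha
    exact hχ.mem _ (hinl a ha)
  · rw [disjoint_left]
    rintro _ ⟨a, ha, rfl⟩ hc
    exact Sum.inl_ne_inr (hχ.injOn (hinl a ha) hc (hinr _ hc).symm)
  · refine hχ.indep.subset ?_
    rintro x (⟨a, ha, rfl⟩ | hx)
    · exact ⟨_, hinl a ha, rfl⟩
    · exact ⟨_, hx, hinr x hx⟩
  · rintro a ⟨haC, haK⟩ b ⟨hbC, hbK⟩
    by_contra hab
    set J₂ : Set (X ⊕ X) := Sum.inl '' T ∪ Sum.inr '' C with hJ₂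
    -- `K` is at least as large as `J₂`. With two lost elements put back it would exceed `J₂` by
    -- two, but it only has room for one extra element, the left copy of `t`.
    have hsub : insert (Sum.inr a) (insert (Sum.inr b) K) ⊆ insert (Sum.inl t) J₂ := by
      have h1 : K ⊆ insert (Sum.inl t) J₂ := by
        refine hK₂.trans (union_subset ?_ (subset_insert _ _))
        rintro _ ⟨a, ha | rfl, rfl⟩
        · exact .inr (.inl ⟨a, ha, rfl⟩)
        · exact .inl rfl
      exact insert_subset (.inr (.inr ⟨a, haC, rfl⟩)) (insert_subset (.inr (.inr ⟨b, hbC, rfl⟩)) h1)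
    have h2 := ncard_le_ncard hsub (toFinite _)
    have h3 : (Sum.inr a : X ⊕ X) ∉ insert (Sum.inr b) K := by
      rintro (h | h)
      · exact hab (Sum.inr_injective h)
      · exact haK h
    rw [ncard_insert_of_notMem h3 (toFinite _),
      ncard_insert_of_notMem (show Sum.inr b ∉ K from hbK) (toFinite _)] at h2
    have h4 := ncard_insert_le (Sum.inl t) J₂
    omega

/-- The invariant of the analysis: the weight covered by an independent set `C` is at most the
weight covered so far and the weight that can still be covered by a set `C'` of centers which can
be used in addition to representatives of the centers chosen so far. -/
theorem GreedyRun.weight_cover_le (h : P.GreedyRun r i T U) (hC : P.M.Indep C) :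
    P.weight (cover C r) ≤ P.weight Uᶜ ∨
      T.ncard = i ∧ ∃ (φ : X → X) (C' : Set X), Represents P.M (P.nbhd r) T φ ∧
        Disjoint (φ '' T) C' ∧ P.M.Indep (φ '' T ∪ C') ∧
        P.weight (cover C r) ≤ P.weight Uᶜ + P.weight (cover C' r ∩ U) := by
  classical
  induction h with
  | init =>
    refine .inr ⟨ncard_empty _, id, C, represents_id P.M.empty_indep, by simp, by simpa, ?_⟩
    simp [weight_empty]
  | @step i T U t hrun ht ih =>
    have hUc : (U \ cover {t} (3 * r))ᶜ = Uᶜ ∪ (cover {t} (3 * r) ∩ U) := by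
      ext x; by_cases hx : x ∈ U <;> simp [hx]
    have hgain : P.weight (U \ cover {t} (3 * r))ᶜ =
        P.weight Uᶜ + P.weight (cover {t} (3 * r) ∩ U) := by
      rw [hUc, weight_union_of_disjoint]
      exact disjoint_left.2 fun x hx hx' => hx hx'.2
    rcases ih with ih | ⟨hcard, φ, C', hφ, hdisj, hind, hle⟩
    · exact .inl (ih.trans (by rw [hgain]; exact le_self_add))
    -- Every remaining `c` competed with `t` in this round, since it can represent itself. It can
    -- equally represent any new center within distance `2r`.
    have hfeas : ∀ c ∈ C', P.RelaxIndep r (T ∪ {c}) ∧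
        ∀ t' ∉ T, dist t' c ≤ 2 * r → Represents P.M (P.nbhd r) (T ∪ {t'})
          (Function.update φ t' c) := by
      intro c hc
      have key : ∀ t' ∉ T, dist t' c ≤ 2 * r → Represents P.M (P.nbhd r) (T ∪ {t'})
          (Function.update φ t' c) := by
        intro t' ht' hd
        rw [union_singleton]
        refine (hφ.mono sdiff_subset).update P.ground_eq (mem_nbhd.2 (by rwa [dist_comm])) ?_
        rw [sdiff_singleton_eq_self ht',
          hφ.indep.notMem_closure_iff (by rw [P.ground_eq]; trivial)]
        exact ⟨hind.subset (insert_subset (.inr hc) subset_union_left),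
          disjoint_right.1 hdisj hc⟩
      refine ⟨?_, key⟩
      by_cases hcT : c ∈ T
      · rw [union_eq_self_of_subset_right (singleton_subset_iff.2 hcT)]
        exact hrun.relaxIndep
      · exact (key c hcT (by simp)).radoIndep
    -- The ball of an old center is already covered, so the maximum gain is zero and nothing of
    -- positive weight is left around `C'`. The bound becomes final, although `T` stops growing with
    -- `i`.
    by_cases htT : t ∈ T
    · left
      have hzero : P.weight (cover {t} r ∩ U) = 0 := by
        convert weight_empty (P := P)
        rw [← disjoint_iff_inter_eq_empty, disjoint_left]
        intro x hx hxU
        rw [hrun.uncovered_eq] at hxU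
        rw [mem_cover_singleton] at hx
        refine hxU (mem_cover.2 ⟨t, htT, hx.trans ?_⟩)
        push_cast
        linarith [r.2]
      have hzero' : P.weight (cover C' r ∩ U) = 0 := by
        rw [weight_eq_zero]
        rintro x ⟨hx, hxU⟩
        obtain ⟨c, hc, hxc⟩ := mem_cover.1 hx
        have h1 := ht.2 c (hfeas c hc).1
        rw [hzero, nonpos_iff_eq_zero, weight_eq_zero] at h1
        exact h1 x ⟨mem_cover_singleton.2 hxc, hxU⟩
      rw [hzero', add_zero] at hle
      exact hle.trans (by rw [hgain]; exact le_self_add)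
    right
    refine ⟨by rw [union_singleton, ncard_insert_of_notMem htT (toFinite _), hcard], ?_⟩
    -- A nearby `c` becomes the representative of `t`. Its `r`-ball lies in the `3r`-ball of `t`, so
    -- removing it from `C'` loses no weight.
    by_cases hnear : ∃ c ∈ C', dist t c ≤ 2 * r
    · obtain ⟨c, hc, hd⟩ := hnear
      have himg : Function.update φ t c '' (T ∪ {t}) = insert c (φ '' T) := by
        rw [union_singleton, image_update_diff (mem_insert t T),
          insert_sdiff_of_mem _ (mem_singleton t), sdiff_singleton_eq_self htT]
      refine ⟨_, C' \ {c}, (hfeas c hc).2 t htT hd, ?_, ?_, ?_⟩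
      · rw [himg, disjoint_left]
        rintro x (rfl | hx) hx'
        · exact hx'.2 rfl
        · exact disjoint_left.1 hdisj hx hx'.1
      · rw [himg]
        refine hind.subset (union_subset (insert_subset (.inr hc) subset_union_left) ?_)
        exact sdiff_subset.trans subset_union_right
      · refine hle.trans ?_
        rw [hgain, add_assoc]
        refine add_le_add_right ((weight_mono ?_).trans (weight_union_le _ _)) _
        rintro x ⟨hx, hxU⟩
        by_cases hxt : x ∈ cover {t} (3 * r)
        · exact .inl ⟨hxt, hxU⟩
        · refine .inr ⟨?_, hxU, hxt⟩
          obtain ⟨c', hc', hxc⟩ := mem_cover.1 hx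
          refine mem_cover.2 ⟨c', ⟨hc', ?_⟩, hxc⟩
          rintro rfl
          refine hxt (mem_cover_singleton.2 ?_)
          have := dist_triangle_right x t c'
          push_cast
          linarith
    -- Now `B(t, r)` misses all `r`-balls around `C'`. Its uncovered weight is therefore gained in
    -- addition to the part of those balls inside `B(t, 3r)`, and pays for the one ball that the
    -- exchange may lose.
    · push Not at hnear
      obtain ⟨ψ, C'', hC'', hψ, hdisj', hind', hsub⟩ := exists_exchange hφ hdisj hind ht.1
      refine ⟨ψ, C'', hψ, hdisj', hind', hle.trans ?_⟩
      rw [hgain, add_assoc]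
      refine add_le_add_right ?_ _
      have hsplit : cover C' r ∩ U ⊆ (cover C' r ∩ (cover {t} (3 * r) ∩ U)) ∪
          ((cover C'' r ∩ (U \ cover {t} (3 * r))) ∪ (cover (C' \ C'') r ∩ U)) := by
        rintro x ⟨hx, hxU⟩
        by_cases hxt : x ∈ cover {t} (3 * r)
        · exact .inl ⟨hx, hxt, hxU⟩
        · obtain ⟨c, hc, hxc⟩ := mem_cover.1 hx
          by_cases hcC : c ∈ C''
          · exact .inr (.inl ⟨mem_cover.2 ⟨c, hcC, hxc⟩, hxU, hxt⟩)
          · exact .inr (.inr ⟨mem_cover.2 ⟨c, ⟨hc, hcC⟩, hxc⟩, hxU⟩)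
      have hlost : P.weight (cover (C' \ C'') r ∩ U) ≤ P.weight (cover {t} r ∩ U) := by
        rcases hsub.eq_empty_or_singleton with h0 | ⟨c, hc⟩
        · simp [h0, cover, weight_empty]
        · rw [hc]
          exact ht.2 c (hfeas c (hc.symm ▸ mem_singleton c : c ∈ C' \ C'').1).1
      have hball : P.weight (cover C' r ∩ (cover {t} (3 * r) ∩ U)) + P.weight (cover {t} r ∩ U) ≤
          P.weight (cover {t} (3 * r) ∩ U) := by
        rw [← weight_union_of_disjoint]
        · refine weight_mono (union_subset inter_subset_right
            (inter_subset_inter_left _ fun x hx => ?_))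
          rw [mem_cover_singleton] at hx ⊢
          push_cast
          linarith [r.2]
        · rw [disjoint_left]
          rintro x ⟨hx, -⟩ ⟨hxt, -⟩
          obtain ⟨c, hc, hxc⟩ := mem_cover.1 hx
          rw [mem_cover_singleton] at hxt
          have := dist_triangle_left t c x
          linarith [hnear c hc]
      calc P.weight (cover C' r ∩ U)
          ≤ P.weight (cover C' r ∩ (cover {t} (3 * r) ∩ U)) +
              (P.weight (cover C'' r ∩ (U \ cover {t} (3 * r))) +
                P.weight (cover (C' \ C'') r ∩ U)) :=
            (weight_mono hsplit).trans ((weight_union_le _ _).trans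
              (add_le_add_right (weight_union_le _ _) _))
        _ ≤ P.weight (cover C' r ∩ (cover {t} (3 * r) ∩ U)) +
              (P.weight (cover C'' r ∩ (U \ cover {t} (3 * r))) +
                P.weight (cover {t} r ∩ U)) := by gcongr
        _ = (P.weight (cover C' r ∩ (cover {t} (3 * r) ∩ U)) + P.weight (cover {t} r ∩ U)) +
              P.weight (cover C'' r ∩ (U \ cover {t} (3 * r))) := by ring
        _ ≤ _ := by gcongr

/-- In the undecided case of the invariant, `T` has as many elements as a base, which forces the
remainder of `C` to be empty. The radius is `3r` to a center plus `2r` to its representative. -/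
theorem IsGreedyOutput.isSolution {R : Set X} (hR : P.IsGreedyOutput r R)
    (hsol : ∃ C : Set X, P.IsSolution r C) : P.IsSolution (5 * r) R := by
  obtain ⟨C, hC, hm⟩ := hsol
  obtain ⟨T, U, hrun, hind, f, hf⟩ := hR
  refine ⟨hind, hm.trans ?_⟩
  have hU : P.weight (cover C r) ≤ P.weight Uᶜ := by
    rcases hrun.weight_cover_le hC with h | ⟨hcard, φ, C', hφ, hdisj, hind', hle⟩
    · exact h
    have h1 := ncard_le_rank hind'
    rw [ncard_union_eq hdisj (toFinite _) (toFinite _), hφ.injOn.ncard_image, hcard] at h1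
    have h2 : C' = ∅ := by
      rw [← ncard_eq_zero (toFinite _)]
      omega
    rw [h2] at hle
    simpa [cover, weight_empty] using hle
  refine hU.trans (weight_mono ?_)
  rw [hrun.uncovered_eq, compl_compl]
  intro x hx
  obtain ⟨y, hy, hxy⟩ := mem_cover.1 hx
  refine mem_cover.2 ⟨f ⟨y, hy⟩, (f ⟨y, hy⟩).2, ?_⟩
  have h1 := mem_nbhd.1 (hf ⟨y, hy⟩)
  have h2 := dist_triangle_right x (f ⟨y, hy⟩ : X) y
  push_cast at hxy ⊢
  linarith

end RMCInstance

end Greedy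

/-! ### Structured programs with bounded loops -/

namespace OracleRAM

/-- Structured commands. All loops are of the form `forN c p`: run `p` for the values
`0, …, n - 1` of the counter in cell `(0, 0)` of array `c`, where `n` is the content of cell
`(0, 0)` of array `0`. -/
inductive Cmd where
  | skip
  | setNat (a : ℕ) (i j x : NatExpr)
  | setReal (a : ℕ) (i j : NatExpr) (x : RealExpr)
  | seq (p q : Cmd)
  | ite (b : Test) (p q : Cmd)
  | forN (c : ℕ) (p : Cmd)

/-- The scalar variable in cell `(0, 0)` of array `a`. -/
def NatExpr.var (a : ℕ) : NatExpr := .read a (.const 0) (.const 0)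

/-- The entry with index `j` of row `0` of array `a`. -/
def NatExpr.entry (a : ℕ) (j : NatExpr) : NatExpr := .read a (.const 0) j

@[simp] theorem NatExpr.eval_const (s : State) (k : ℕ) : (NatExpr.const k).eval s = k := rfl

@[simp] theorem NatExpr.eval_add (s : State) (x y : NatExpr) :
    (NatExpr.add x y).eval s = x.eval s + y.eval s := rfl

@[simp] theorem NatExpr.eval_sub (s : State) (x y : NatExpr) :
    (NatExpr.sub x y).eval s = x.eval s - y.eval s := rfl

@[simp] theorem NatExpr.eval_var (s : State) (a : ℕ) : (NatExpr.var a).eval s = s.nat a 0 0 := rfl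

@[simp] theorem NatExpr.eval_entry (s : State) (a : ℕ) (j : NatExpr) :
    (NatExpr.entry a j).eval s = s.nat a 0 (j.eval s) := rfl

@[simp] theorem RealExpr.eval_zero (s : State) : RealExpr.zero.eval s = 0 := rfl

@[simp] theorem RealExpr.eval_read (s : State) (a : ℕ) (i j : NatExpr) :
    (RealExpr.read a i j).eval s = s.real a (i.eval s) (j.eval s) := rfl

@[simp] theorem RealExpr.eval_add (s : State) (x y : RealExpr) :
    (RealExpr.add x y).eval s = x.eval s + y.eval s := rfl

@[simp] theorem Test.holds_natLE (O : Set ℕ → Prop) (s : State) (x y : NatExpr) :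
    (Test.natLE x y).Holds O s ↔ x.eval s ≤ y.eval s := Iff.rfl

@[simp] theorem Test.holds_realLE (O : Set ℕ → Prop) (s : State) (x y : RealExpr) :
    (Test.realLE x y).Holds O s ↔ x.eval s ≤ y.eval s := Iff.rfl

@[simp] theorem Test.holds_indep (O : Set ℕ → Prop) (s : State) (a : ℕ) (i : NatExpr) :
    (Test.indep a i).Holds O s ↔ O {j | s.nat a (i.eval s) j ≠ 0} := Iff.rfl

namespace State

variable {s : State} {a b i j v : ℕ} {w : ℝ}

theorem writeNat_nat_of_ne (h : b ≠ a) : (s.writeNat a i j v).nat b = s.nat b := by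
  funext i' j'
  simp [writeNat, h]

theorem writeNat_nat_self (i' j' : ℕ) :
    (s.writeNat a i j v).nat a i' j' = if i' = i ∧ j' = j then v else s.nat a i' j' := by
  simp [writeNat]

@[simp] theorem writeNat_real : (s.writeNat a i j v).real = s.real := rfl

@[simp] theorem writeReal_nat : (s.writeReal a i j w).nat = s.nat := rfl

theorem writeReal_real_of_ne (h : b ≠ a) : (s.writeReal a i j w).real b = s.real b := by
  funext i' j'
  simp [writeReal, h]

theorem writeReal_real_self (i' j' : ℕ) :
    (s.writeReal a i j w).real a i' j' = if i' = i ∧ j' = j then w else s.real a i' j' := by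
  simp [writeReal]

end State

/-! ### Compilation, frame rules and running time of bounded-loop commands -/

namespace Cmd

/-- The machine program of a command. -/
def compile : Cmd → Program
  | skip => .nop
  | setNat a i j x => .setNat a i j x
  | setReal a i j x => .setReal a i j x
  | seq p q => .seq p.compile q.compile
  | ite b p q => .cond b p.compile q.compile
  | forN c p => .seq (.setNat c (.const 0) (.const 0) (.const 0))
      (.loop (.natLE (.add (.var c) (.const 1)) (.var 0))
        (.seq p.compile (.setNat c (.const 0) (.const 0) (.add (.var c) (.const 1)))))

open Classical in
/-- The state after the execution of a command. -/
noncomputable def run (O : Set ℕ → Prop) : Cmd → State → State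
  | skip => fun s => s
  | setNat a i j x => fun s => s.writeNat a (i.eval s) (j.eval s) (x.eval s)
  | setReal a i j x => fun s => s.writeReal a (i.eval s) (j.eval s) (x.eval s)
  | seq p q => fun s => q.run O (p.run O s)
  | ite b p q => fun s => if b.Holds O s then p.run O s else q.run O s
  | forN c p => fun s => Nat.rec (s.writeNat c 0 0 0)
      (fun i st => (p.run O st).writeNat c 0 0 (i + 1)) (s.nat 0 0 0)

/-- Whether the command may write to the array `a` of natural numbers. -/
def writesNat : Cmd → ℕ → Bool
  | skip, _ => false
  | setNat a _ _ _, b => a == b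
  | setReal _ _ _ _, _ => false
  | seq p q, b => p.writesNat b || q.writesNat b
  | ite _ p q, b => p.writesNat b || q.writesNat b
  | forN c p, b => c == b || p.writesNat b

/-- Whether the command may write to the array `a` of real numbers. -/
def writesReal : Cmd → ℕ → Bool
  | skip, _ => false
  | setNat _ _ _ _, _ => false
  | setReal a _ _ _, b => a == b
  | seq p q, b => p.writesReal b || q.writesReal b
  | ite _ p q, b => p.writesReal b || q.writesReal b
  | forN _ p, b => p.writesReal b

/-- No loop body writes to the counter of its loop. -/
def WellFormed : Cmd → Bool
  | seq p q => p.WellFormed && q.WellFormed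
  | ite _ p q => p.WellFormed && q.WellFormed
  | forN c p => p.WellFormed && !p.writesNat c
  | _ => true

/-- A bound on the number of steps. -/
noncomputable def cost : Cmd → Polynomial ℕ
  | seq p q => p.cost + q.cost
  | ite _ p q => p.cost + q.cost + 1
  | forN _ p => .X * (p.cost + 2) + 2
  | _ => 1

variable {O : Set ℕ → Prop}

theorem run_skip (s : State) : skip.run O s = s := rfl

theorem run_seq (p q : Cmd) (s : State) : (seq p q).run O s = q.run O (p.run O s) := rfl

theorem run_setReal (a : ℕ) (i j : NatExpr) (x : RealExpr) (s : State) :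
    (setReal a i j x).run O s = s.writeReal a (i.eval s) (j.eval s) (x.eval s) := rfl

theorem run_ite_of_pos {b : Test} {s : State} (h : b.Holds O s) (p q : Cmd) :
    (ite b p q).run O s = p.run O s := if_pos h

theorem run_ite_of_neg {b : Test} {s : State} (h : ¬ b.Holds O s) (p q : Cmd) :
    (ite b p q).run O s = q.run O s := if_neg h

/-- A frame rule by syntax: for a concrete command the hypothesis is a Boolean computation, so
untouched arrays need no place in the loop invariants. -/
theorem run_nat_eq {a : ℕ} (p : Cmd) (s : State) (h : p.writesNat a = false) :
    (p.run O s).nat a = s.nat a := by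
  induction p generalizing s with
  | skip => rfl
  | setNat b i j x =>
    refine State.writeNat_nat_of_ne ?_
    rintro rfl
    simp [writesNat] at h
  | setReal b i j x => rfl
  | seq p q ihp ihq =>
    simp only [writesNat, Bool.or_eq_false_iff] at h
    exact (ihq _ h.2).trans (ihp _ h.1)
  | ite b p q ihp ihq =>
    simp only [writesNat, Bool.or_eq_false_iff] at h
    by_cases hb : b.Holds O s
    · simpa only [run, if_pos hb] using ihp _ h.1
    · simpa only [run, if_neg hb] using ihq _ h.2
  | forN c p ih =>
    simp only [writesNat, Bool.or_eq_false_iff, beq_eq_false_iff_ne] at h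
    simp only [run]
    induction s.nat 0 0 0 with
    | zero => exact State.writeNat_nat_of_ne h.1.symm
    | succ i hi => exact (State.writeNat_nat_of_ne h.1.symm).trans ((ih _ h.2).trans hi)

theorem run_real_eq {a : ℕ} (p : Cmd) (s : State) (h : p.writesReal a = false) :
    (p.run O s).real a = s.real a := by
  induction p generalizing s with
  | skip => rfl
  | setNat b i j x => rfl
  | setReal b i j x =>
    refine State.writeReal_real_of_ne ?_
    rintro rfl
    simp [writesReal] at h
  | seq p q ihp ihq =>
    simp only [writesReal, Bool.or_eq_false_iff] at h
    exact (ihq _ h.2).trans (ihp _ h.1)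
  | ite b p q ihp ihq =>
    simp only [writesReal, Bool.or_eq_false_iff] at h
    by_cases hb : b.Holds O s
    · simpa only [run, if_pos hb] using ihp _ h.1
    · simpa only [run, if_neg hb] using ihq _ h.2
  | forN c p ih =>
    simp only [run]
    induction s.nat 0 0 0 with
    | zero => rfl
    | succ i hi => exact (ih _ h).trans hi

/-- The invariant rule for loops. -/
theorem run_forN_induction (I : ℕ → State → Prop) (c : ℕ) (p : Cmd) (s : State)
    (hp : p.writesNat c = false) (h0 : I 0 (s.writeNat c 0 0 0))
    (hstep : ∀ i < s.nat 0 0 0, ∀ st : State, I i st → st.nat c 0 0 = i →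
      (∀ a, (forN c p).writesNat a = false → st.nat a = s.nat a) →
      (∀ a, p.writesReal a = false → st.real a = s.real a) →
      (p.run O st).nat c 0 0 = i → I (i + 1) ((p.run O st).writeNat c 0 0 (i + 1))) :
    I (s.nat 0 0 0) ((forN c p).run O s) := by
  have key : ∀ m ≤ s.nat 0 0 0, ∀ st : State,
      st = Nat.rec (motive := fun _ => State) (s.writeNat c 0 0 0)
        (fun i st => (p.run O st).writeNat c 0 0 (i + 1)) m →
      I m st ∧ st.nat c 0 0 = m ∧
      (∀ a, (forN c p).writesNat a = false → st.nat a = s.nat a) ∧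
      (∀ a, p.writesReal a = false → st.real a = s.real a) := by
    intro m
    induction m with
    | zero =>
      rintro - st rfl
      refine ⟨h0, by simp [State.writeNat_nat_self], fun a ha => ?_, fun a _ => rfl⟩
      simp only [writesNat, Bool.or_eq_false_iff, beq_eq_false_iff_ne] at ha
      exact State.writeNat_nat_of_ne ha.1.symm
    | succ m ih =>
      rintro hm _ rfl
      obtain ⟨h1, h2, h3, h4⟩ := ih (Nat.le_of_succ_le hm) _ rfl
      refine ⟨hstep m hm _ h1 h2 h3 h4 ?_, by simp [State.writeNat_nat_self], fun a ha => ?_,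
        fun a ha => (run_real_eq p _ ha).trans (h4 a ha)⟩
      · rw [run_nat_eq p _ hp]
        exact h2
      · have ha' := ha
        simp only [writesNat, Bool.or_eq_false_iff, beq_eq_false_iff_ne] at ha
        exact (State.writeNat_nat_of_ne ha.1.symm).trans ((run_nat_eq p _ ha.2).trans (h3 a ha'))
  exact (key _ le_rfl _ rfl).1

/-- `run` fixes the number of iterations at the start and sets the counter outright, whereas the
compiled loop rereads the bound and increments. The two agree because neither array `0` nor the
counter is written by the body. -/
theorem exec_compile (p : Cmd) (n : ℕ) (s : State) (hwf : p.WellFormed = true)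
    (h0 : p.writesNat 0 = false) (hn : s.nat 0 0 0 = n) :
    ∃ k ≤ p.cost.eval n, Exec O p.compile s (p.run O s) k := by
  induction p generalizing s with
  | skip => exact ⟨1, by simp [cost], .nop s⟩
  | setNat b i j x => exact ⟨1, by simp [cost], .setNat s b i j x⟩
  | setReal b i j x => exact ⟨1, by simp [cost], .setReal s b i j x⟩
  | seq p q ihp ihq =>
    simp only [writesNat, Bool.or_eq_false_iff] at h0
    simp only [WellFormed, Bool.and_eq_true] at hwf
    obtain ⟨k, hk, hek⟩ := ihp s hwf.1 h0.1 hn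
    obtain ⟨l, hl, hel⟩ := ihq (p.run O s) hwf.2 h0.2 (by rw [run_nat_eq p s h0.1, hn])
    refine ⟨k + l, ?_, .seq hek hel⟩
    simp only [cost, Polynomial.eval_add]
    omega
  | ite b p q ihp ihq =>
    simp only [writesNat, Bool.or_eq_false_iff] at h0
    simp only [WellFormed, Bool.and_eq_true] at hwf
    by_cases hb : b.Holds O s
    · obtain ⟨k, hk, hek⟩ := ihp s hwf.1 h0.1 hn
      refine ⟨k + 1, ?_, ?_⟩
      · simp only [cost, Polynomial.eval_add, Polynomial.eval_one]
        omega
      · simp only [run, if_pos hb]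
        exact .cond_true hb hek
    · obtain ⟨k, hk, hek⟩ := ihq s hwf.2 h0.2 hn
      refine ⟨k + 1, ?_, ?_⟩
      · simp only [cost, Polynomial.eval_add, Polynomial.eval_one]
        omega
      · simp only [run, if_neg hb]
        exact .cond_false hb hek
  | forN c p ih =>
    simp only [writesNat, Bool.or_eq_false_iff, beq_eq_false_iff_ne] at h0
    simp only [WellFormed, Bool.and_eq_true, Bool.not_eq_true'] at hwf
    set F : ℕ → State := fun m => Nat.rec (motive := fun _ => State) (s.writeNat c 0 0 0)
      (fun i st => (p.run O st).writeNat c 0 0 (i + 1)) m with hF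
    have hFc : ∀ m, (F m).nat c 0 0 = m := by
      intro m
      cases m <;> simp [hF, State.writeNat_nat_self]
    have hF0 : ∀ m, (F m).nat 0 0 0 = n := by
      intro m
      induction m with
      | zero => simpa [hF, State.writeNat_nat_of_ne h0.1.symm] using hn
      | succ m ihm =>
        rw [← ihm]
        simp only [hF]
        rw [State.writeNat_nat_of_ne h0.1.symm, run_nat_eq p _ h0.2]
    -- Here `j` counts the remaining iterations. Each pays for the body, one test and one increment;
    -- the final `1` is the failing test.
    have hloop : ∀ j m, m + j = n → ∃ k ≤ j * (p.cost.eval n + 2) + 1,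
        Exec O (.loop (.natLE (.add (.var c) (.const 1)) (.var 0))
          (.seq p.compile (.setNat c (.const 0) (.const 0) (.add (.var c) (.const 1)))))
          (F m) (F n) k := by
      intro j
      induction j with
      | zero =>
        rintro m rfl
        refine ⟨1, by simp, .loop_false ?_⟩
        simp only [Test.holds_natLE, NatExpr.eval_add, NatExpr.eval_var, NatExpr.eval_const, hFc,
          hF0]
        omega
      | succ j ihj =>
        intro m hm
        obtain ⟨k, hk, hek⟩ := ih (F m) hwf.1 h0.2 (hF0 m)
        obtain ⟨l, hl, hel⟩ := ihj (m + 1) (by omega)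
        refine ⟨(k + 1) + l + 1, ?_, .loop_true ?_ (.seq hek ?_) hel⟩
        · rw [Nat.succ_mul]
          omega
        · simp only [Test.holds_natLE, NatExpr.eval_add, NatExpr.eval_var, NatExpr.eval_const, hFc,
            hF0]
          omega
        · have h1 := Exec.setNat (O := O) (p.run O (F m)) c (.const 0) (.const 0)
            (.add (.var c) (.const 1))
          simp only [NatExpr.eval_add, NatExpr.eval_var, NatExpr.eval_const,
            run_nat_eq p _ hwf.2, hFc] at h1
          exact h1
    obtain ⟨k, hk, hek⟩ := hloop n 0 (by omega)
    refine ⟨1 + k, ?_, ?_⟩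
    · simp only [cost, Polynomial.eval_add, Polynomial.eval_mul, Polynomial.eval_X,
        Polynomial.eval_ofNat]
      omega
    · have h1 := Exec.setNat (O := O) s c (.const 0) (.const 0) (.const 0)
      refine .seq h1 ?_
      simp only [run, hn]
      exact hek

end Cmd

end OracleRAM

/-! ### The program -/

namespace OracleRAM

namespace Center

open NatExpr

/-! Names of arrays. -/

local notation "aSize" => (0 : ℕ)
local notation "aSet" => (1 : ℕ)
local notation "aBase" => (2 : ℕ)
local notation "aRep" => (3 : ℕ)
local notation "aCov" => (4 : ℕ)
local notation "aVis" => (5 : ℕ)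
local notation "aDead" => (6 : ℕ)
local notation "vCenter" => (7 : ℕ)
local notation "vNbr" => (8 : ℕ)
local notation "vSrc" => (9 : ℕ)
local notation "vOmit" => (10 : ℕ)
local notation "vFree" => (11 : ℕ)
local notation "vFound" => (12 : ℕ)
local notation "vFoundSrc" => (13 : ℕ)
local notation "vFoundNbr" => (14 : ℕ)
local notation "vFlag" => (15 : ℕ)
local notation "vBest" => (16 : ℕ)
local notation "vCount" => (17 : ℕ)
local notation "vTgt" => (18 : ℕ)
local notation "vRound" => (19 : ℕ)
local notation "vRestart" => (20 : ℕ)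
local notation "vCand" => (21 : ℕ)
local notation "vMain" => (22 : ℕ)
local notation "rDist" => (0 : ℕ)
local notation "rWeight" => (1 : ℕ)
local notation "rRadius" => (3 : ℕ)
local notation "rAcc" => (4 : ℕ)
local notation "rBest" => (5 : ℕ)

/-- Assignment to a scalar variable. -/
def assign (a : ℕ) (x : NatExpr) : Cmd := .setNat a (.const 0) (.const 0) x

/-- Assignment to an entry of row `0` of an array. -/
def store (a : ℕ) (j x : NatExpr) : Cmd := .setNat a (.const 0) j x

/-- The condition `x ≠ 0`. -/
def isPos (x : NatExpr) : Test := .natLE (.const 1) x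

/-- The condition `x ≠ y`. -/
def differ (x y : NatExpr) : Test := isPos (.add (.sub x y) (.sub y x))

/-- The radius. -/
def radius : RealExpr := .read rRadius (.const 0) (.const 0)

/-- Set row `0` of an array to zero. -/
def clear (a : ℕ) : Cmd := .forN vCount (store a (var vCount) (.const 0))

/-- Store the set of the representatives of all centers except `vOmit`. -/
def fill : Cmd :=
  .seq (clear aSet)
    (.forN vCount (.ite (isPos (entry aRep (var vCount)))
      (.ite (differ (var vCount) (var vOmit))
        (store aSet (.sub (entry aRep (var vCount)) (.const 1)) (.const 1)) .skip) .skip))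

/-- Test whether `vNbr` lies outside the span of the representatives of all centers except
`vOmit`. -/
def testFree : Cmd :=
  .seq fill (.seq (assign vFree (.const 0))
    (.ite (isPos (entry aSet (var vNbr))) .skip
      (.seq (store aSet (var vNbr) (.const 1))
        (.ite (.indep aSet (.const 0)) (assign vFree (.const 1)) .skip))))

/-- Mark all centers whose representative can be exchanged for `vNbr`. -/
def grow : Cmd :=
  .forN vTgt (.ite (isPos (entry aRep (var vTgt)))
    (.ite (isPos (entry aDead (var vTgt))) .skip
      (.seq (assign vOmit (var vTgt)) (.seq testFree
        (.ite (isPos (var vFree)) (store aVis (var vTgt) (.const 1)) .skip)))) .skip)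

/-- Process the neighbour `vNbr` of `vSrc`. -/
def visit : Cmd :=
  .seq (assign vOmit (var aSize)) (.seq testFree
    (.ite (isPos (var vFree))
      (.seq (assign vFound (.const 1)) (.seq (assign vFoundSrc (var vSrc))
        (assign vFoundNbr (var vNbr))))
      grow))

/-- Process all neighbours of `vSrc`. -/
def visitAll : Cmd :=
  .forN vNbr (.ite (.realLE (.read rDist (var vSrc) (var vNbr)) (.add radius radius)) visit .skip)

/-- Process all marked points. -/
def pass : Cmd :=
  .forN vSrc (.ite (isPos (entry aVis (var vSrc))) visitAll .skip)

/-- Search for an augmenting path from `vCenter`. -/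
def explore : Cmd :=
  .seq (clear aVis) (.seq (store aVis (var vCenter) (.const 1)) (.seq (assign vFound (.const 0))
    (.forN vRound pass)))

/-- Search for an augmenting path, and perform its last exchange. -/
def restart : Cmd :=
  .ite (isPos (var vFlag)) .skip (.seq explore (.ite (isPos (var vFound))
    (.ite (differ (var vFoundSrc) (var vCenter))
      (.seq (store aRep (var vFoundSrc) (.add (var vFoundNbr) (.const 1)))
        (store aDead (var vFoundSrc) (.const 1)))
      (assign vFlag (.const 1))) .skip))

/-- Decide whether `vCenter` can be added to the centers, and move representatives so that it has
a free representative in this case. -/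
def augment : Cmd :=
  .ite (isPos (entry aRep (var vCenter)))
    (.seq (assign vFlag (.const 1))
      (assign vFoundNbr (.sub (entry aRep (var vCenter)) (.const 1))))
    (.seq (assign vFlag (.const 0)) (.seq (clear aDead) (.forN vRestart restart)))

/-- Compute the weight of the uncovered points in the ball around `vCenter`. -/
def weigh : Cmd :=
  .seq (.setReal rAcc (.const 0) (.const 0) .zero)
    (.forN vCount (.ite (.realLE (.read rDist (var vCenter) (var vCount)) radius)
      (.ite (isPos (entry aCov (var vCount))) .skip
        (.setReal rAcc (.const 0) (.const 0) (.add (.read rAcc (.const 0) (.const 0))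
          (.read rWeight (.const 0) (var vCount))))) .skip))

/-- Record `vCenter` as the best candidate so far. -/
def record : Cmd :=
  .seq (assign vBest (.add (var vCenter) (.const 1)))
    (.setReal rBest (.const 0) (.const 0) (.read rAcc (.const 0) (.const 0)))

/-- Compare `vCenter` with the best candidate so far. -/
def compare : Cmd :=
  .seq weigh (.ite (isPos (var vBest))
    (.ite (.realLE (.read rAcc (.const 0) (.const 0)) (.read rBest (.const 0) (.const 0)))
      .skip record)
    record)

/-- Find the best candidate. -/
def select : Cmd :=
  .seq (assign vBest (.const 0))
    (.forN vCand (.seq (assign vCenter (var vCand)) (.seq augment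
      (.ite (isPos (var vFlag)) compare .skip))))

/-- Mark the points in the ball of radius `3r` around `vCenter` as covered. -/
def markCovered : Cmd :=
  .forN vCount (.ite (.realLE (.read rDist (var vCenter) (var vCount))
    (.add radius (.add radius radius))) (store aCov (var vCount) (.const 1)) .skip)

/-- One iteration of the greedy procedure. -/
def greedyStep : Cmd :=
  .seq select (.seq (assign vCenter (.sub (var vBest) (.const 1))) (.seq augment
    (.seq (store aRep (var vCenter) (.add (var vFoundNbr) (.const 1))) markCovered)))

/-- Compute a base of the matroid. -/
def findBase : Cmd :=
  .forN vMain (.seq (store aBase (var vMain) (.const 1))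
    (.ite (.indep aBase (.const 0)) .skip (store aBase (var vMain) (.const 0))))

/-- The greedy algorithm. -/
def main : Cmd :=
  .seq findBase (.seq
    (.forN vMain (.ite (isPos (entry aBase (var vMain))) greedyStep .skip))
    (.seq (assign vOmit (var aSize)) fill))

/-! ### Correctness of the program -/

/-! ### Sets of points stored as rows of memory -/

section Numbering

variable {X : Type*} [Fintype X] (e : Fin (Fintype.card X) ≃ X) {A : ℕ → ℕ → ℕ}

/-- The number of a point. -/
def num (x : X) : ℕ := (e.symm x : Fin (Fintype.card X))

/-- The set of points marked in row `0` of an array. -/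
def marked (A : ℕ → ℕ → ℕ) : Set X := {x | A 0 (num e x) ≠ 0}

theorem num_lt (x : X) : num e x < Fintype.card X := (e.symm x).2

theorem num_inj {x y : X} : num e x = num e y ↔ x = y := by
  simp [num, Fin.val_inj]

theorem exists_num {i : ℕ} (hi : i < Fintype.card X) : ∃ x, num e x = i :=
  ⟨e ⟨i, hi⟩, by simp [num]⟩

theorem mem_marked {x : X} : x ∈ marked e A ↔ A 0 (num e x) ≠ 0 := Iff.rfl

theorem marked_writeNat {s : State} {a v : ℕ} {x : X} (hv : v ≠ 0) :
    marked e ((s.writeNat a 0 (num e x) v).nat a) = insert x (marked e (s.nat a)) := by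
  ext y
  simp only [mem_marked, State.writeNat_nat_self, true_and, num_inj, Set.mem_insert_iff]
  by_cases h : y = x <;> simp [h, hv, num_inj]

end Numbering

theorem holds_isPos {O : Set ℕ → Prop} {s : State} {x : NatExpr} :
    (isPos x).Holds O s ↔ x.eval s ≠ 0 := Nat.one_le_iff_ne_zero

theorem run_assign (O : Set ℕ → Prop) (a : ℕ) (x : NatExpr) (s : State) :
    (assign a x).run O s = s.writeNat a 0 0 (x.eval s) := rfl

theorem run_store (O : Set ℕ → Prop) (a : ℕ) (j x : NatExpr) (s : State) :
    (store a j x).run O s = s.writeNat a 0 (j.eval s) (x.eval s) := rfl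

theorem holds_differ {O : Set ℕ → Prop} {s : State} {x y : NatExpr} :
    (differ x y).Holds O s ↔ x.eval s ≠ y.eval s := by
  rw [differ, holds_isPos]
  simp only [eval_add, eval_sub]
  omega

section Clear

open Set

theorem run_clear {X : Type*} [Fintype X] {e : Fin (Fintype.card X) ≃ X} {s : State} {a : ℕ}
    (O : Set ℕ → Prop) (ha : a ≠ vCount) (hn : s.nat aSize 0 0 = Fintype.card X) :
    marked e (((clear a).run O s).nat a) = ∅ := by
  have key := Cmd.run_forN_induction (O := O) (fun i st => ∀ j < i, st.nat a 0 j = 0) vCount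
    (store a (var vCount) (.const 0)) s (by simpa [store, Cmd.writesNat] using ha) (by simp) ?_
  · rw [hn] at key
    ext x
    simp only [mem_marked, mem_empty_iff_false, iff_false, not_not]
    exact key _ (num_lt e x)
  · intro i _ st hI hc _ _ _ j hj
    rw [State.writeNat_nat_of_ne ha]
    simp only [store, Cmd.run, eval_const, eval_var, hc, State.writeNat_nat_self, true_and]
    split_ifs with h
    · rfl
    · exact hI j (by omega)

end Clear

/-! ### Memory layout and the span test -/

section Correctness

open Set

variable {X : Type*} [Fintype X] [MetricSpace X]

variable {P : RMCInstance X} {r : ℝ≥0} {e : Fin (Fintype.card X) ≃ X} {s s' s'' : State}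
  {T D V : Set X} {φ : X → X} {t x y z : X} {a : ℕ}

/-- The memory holds the instance, and the array `aRep` stores the representatives `φ` of the
centers `T`. -/
structure Holds (P : RMCInstance X) (r : ℝ≥0) (e : Fin (Fintype.card X) ≃ X) (s : State)
    (T : Set X) (φ : X → X) : Prop where
  size : s.nat aSize 0 0 = Fintype.card X
  dist : ∀ x y, s.real rDist (num e x) (num e y) = dist x y
  weight : ∀ x, s.real rWeight 0 (num e x) = P.w x
  radius : s.real rRadius 0 0 = r
  rep : ∀ x ∈ T, s.nat aRep 0 (num e x) = num e (φ x) + 1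
  rep_of_notMem : ∀ x ∉ T, s.nat aRep 0 (num e x) = 0
  represents : Represents P.M (P.nbhd r) T φ

/-- The input occupies only real arrays with name below `4`; the accumulator and the best value so
far lie above and may change freely. -/
theorem Holds.congr (h : Holds P r e s T φ) (h0 : s'.nat aSize = s.nat aSize)
    (h3 : s'.nat aRep = s.nat aRep) (hr : ∀ a < 4, s'.real a = s.real a) : Holds P r e s' T φ where
  size := by rw [h0, h.size]
  dist := by rw [hr _ (by norm_num)]; exact h.dist
  weight := by rw [hr _ (by norm_num)]; exact h.weight
  radius := by rw [hr _ (by norm_num)]; exact h.radius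
  rep := by rw [h3]; exact h.rep
  rep_of_notMem := by rw [h3]; exact h.rep_of_notMem
  represents := h.represents

/-- Representatives are stored with offset one, so that zero can mean "not a center" and one array
encodes both `T` and `φ`. -/
theorem Holds.rep_ne_zero (h : Holds P r e s T φ) : s.nat aRep 0 (num e x) ≠ 0 ↔ x ∈ T := by
  by_cases hx : x ∈ T
  · simp [hx, h.rep x hx]
  · simp [hx, h.rep_of_notMem x hx]

/-- Assigning the representative `x` to `y`. -/
theorem Holds.update [DecidableEq X] (h : Holds P r e s T φ)
    (h' : Represents P.M (P.nbhd r) (insert y T) (Function.update φ y x)) :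
    Holds P r e (s.writeNat aRep 0 (num e y) (num e x + 1)) (insert y T)
      (Function.update φ y x) where
  size := by rw [State.writeNat_nat_of_ne (by norm_num), h.size]
  dist := h.dist
  weight := h.weight
  radius := h.radius
  rep := by
    intro z hz
    simp only [State.writeNat_nat_self, true_and, num_inj]
    by_cases hzy : z = y
    · simp [hzy]
    · rw [if_neg hzy, h.rep z (hz.resolve_left hzy), Function.update_of_ne hzy]
  rep_of_notMem := by
    intro z hz
    rw [mem_insert_iff, not_or] at hz
    simp only [State.writeNat_nat_self, true_and, num_inj, if_neg hz.1]
    exact h.rep_of_notMem z hz.2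
  represents := h'

theorem oracle_iff (A : ℕ → ℕ → ℕ) : P.oracle e {j | A 0 j ≠ 0} ↔ P.M.Indep (marked e A) := Iff.rfl

/-- Since no point has number `Fintype.card X`, setting `vOmit` to that value omits nothing. The
same routine thus serves both span tests and the output. -/
theorem run_fill (O : Set ℕ → Prop) (h : Holds P r e s T φ) :
    marked e ((fill.run O s).nat aSet) = φ '' {y | y ∈ T ∧ num e y ≠ s.nat vOmit 0 0} := by
  set s₁ := (clear aSet).run O s with hs₁
  have h₁ : Holds P r e s₁ T φ := h.congr (Cmd.run_nat_eq _ _ rfl) (Cmd.run_nat_eq _ _ rfl)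
    fun a _ => Cmd.run_real_eq _ _ rfl
  have hclear : marked e (s₁.nat aSet) = ∅ := run_clear O (by norm_num) h.size
  have homit : s₁.nat vOmit = s.nat vOmit := Cmd.run_nat_eq _ _ rfl
  have key := Cmd.run_forN_induction (O := O)
    (fun i st => marked e (st.nat aSet) =
      φ '' {y | (y ∈ T ∧ num e y ≠ s.nat vOmit 0 0) ∧ num e y < i}) vCount
    (.ite (isPos (entry aRep (var vCount))) (.ite (differ (var vCount) (var vOmit))
        (store aSet (.sub (entry aRep (var vCount)) (.const 1)) (.const 1)) .skip) .skip)
    s₁ rfl ?_ ?_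
  · rw [h₁.size] at key
    refine key.trans ?_
    simp only [num_lt, and_true]
  · rw [State.writeNat_nat_of_ne (by norm_num)]
    simpa using hclear
  · intro i hi st hI hc hN _ _
    rw [h₁.size] at hi
    obtain ⟨y, rfl⟩ := exists_num e hi
    rw [State.writeNat_nat_of_ne (by norm_num)]
    have hcounter : (var vCount).eval st = num e y := hc
    have hent : (entry aRep (var vCount)).eval st = s₁.nat aRep 0 (num e y) := by
      rw [eval_entry, hcounter, hN aRep rfl]
    have homit' : (var vOmit).eval st = s.nat vOmit 0 0 := by rw [eval_var, hN vOmit rfl, homit]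
    have hsame : ¬ (y ∈ T ∧ num e y ≠ s.nat vOmit 0 0) →
        φ '' {z | (z ∈ T ∧ num e z ≠ s.nat vOmit 0 0) ∧ num e z < num e y} =
        φ '' {z | (z ∈ T ∧ num e z ≠ s.nat vOmit 0 0) ∧ num e z < num e y + 1} := by
      intro hy
      congr 1
      ext z
      refine and_congr_right fun hz => ?_
      have : num e z ≠ num e y := by
        rw [Ne, num_inj]
        rintro rfl
        exact hy hz
      omega
    by_cases hy : y ∈ T
    · rw [Cmd.run_ite_of_pos (by rwa [holds_isPos, hent, h₁.rep_ne_zero])]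
      by_cases hyo : num e y ≠ s.nat vOmit 0 0
      · rw [Cmd.run_ite_of_pos (by rwa [holds_differ, hcounter, homit']), run_store, eval_sub, hent,
          h₁.rep y hy, eval_const, Nat.add_sub_cancel, marked_writeNat e one_ne_zero, hI,
          ← image_insert_eq]
        congr 1
        ext z
        simp only [mem_insert_iff, mem_ofPred_eq]
        by_cases hzy : z = y
        · subst hzy
          simp [hy, hyo]
        · have : num e z ≠ num e y := by rwa [Ne, num_inj]
          simp only [hzy, false_or]
          refine and_congr_right fun _ => ?_
          omega
      · rw [Cmd.run_ite_of_neg (by rwa [holds_differ, hcounter, homit']), Cmd.run_skip, hI]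
        exact hsame fun h' => hyo h'.2
    · rw [Cmd.run_ite_of_neg (by rwa [holds_isPos, hent, h₁.rep_ne_zero]), Cmd.run_skip, hI]
      exact hsame fun h' => hy h'.1

/-- A point is outside the span of an independent set exactly if it is not a member and can be added
independently. Membership needs its own test, because inserting a member would pass the oracle. -/
theorem run_testFree (h : Holds P r e s T φ) (hx : s.nat vNbr 0 0 = num e x) :
    (testFree.run (P.oracle e) s).nat vFree 0 0 ≠ 0 ↔
      x ∉ P.M.closure (φ '' {y | y ∈ T ∧ num e y ≠ s.nat vOmit 0 0}) := by
  have hind : P.M.Indep (φ '' {y | y ∈ T ∧ num e y ≠ s.nat vOmit 0 0}) :=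
    h.represents.indep.subset (image_mono fun y hy => hy.1)
  rw [hind.notMem_closure_iff (by rw [P.ground_eq]; trivial), ← run_fill (P.oracle e) h,
    testFree, Cmd.run_seq, Cmd.run_seq, run_assign, eval_const]
  have hx' : (fill.run (P.oracle e) s).nat vNbr 0 0 = num e x := by
    rw [Cmd.run_nat_eq _ _ rfl, hx]
  set s₁ := fill.run (P.oracle e) s
  set s₂ := s₁.writeNat vFree 0 0 0 with hs₂
  have hset : s₂.nat aSet = s₁.nat aSet := State.writeNat_nat_of_ne (by norm_num)
  have hnbr : (var vNbr).eval s₂ = num e x := by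
    rw [eval_var, State.writeNat_nat_of_ne (by norm_num), hx']
  have hfree : s₂.nat vFree 0 0 = 0 := by simp [hs₂, State.writeNat_nat_self]
  by_cases hm : x ∈ marked e (s₁.nat aSet)
  · rw [Cmd.run_ite_of_pos (by rwa [holds_isPos, eval_entry, hnbr, hset]), Cmd.run_skip, hfree]
    simp [hm]
  · rw [Cmd.run_ite_of_neg (by rwa [holds_isPos, eval_entry, hnbr, hset]), Cmd.run_seq, run_store,
      hnbr, eval_const]
    have hor : (Test.indep aSet (.const 0)).Holds (P.oracle e) (s₂.writeNat aSet 0 (num e x) 1) ↔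
        P.M.Indep (insert x (marked e (s₁.nat aSet))) := by
      rw [Test.holds_indep, eval_const, oracle_iff, marked_writeNat e one_ne_zero, hset]
    by_cases hi : P.M.Indep (insert x (marked e (s₁.nat aSet)))
    · rw [Cmd.run_ite_of_pos (hor.2 hi), run_assign]
      simp [State.writeNat_nat_self, hm, hi]
    · rw [Cmd.run_ite_of_neg (fun h' => hi (hor.1 h')), Cmd.run_skip,
        State.writeNat_nat_of_ne (by norm_num), hfree]
      simp [hi]

end Correctness

/-! ### Monotone progress of a search -/

section Progress

open Set

variable {X : Type*} [Fintype X] {e : Fin (Fintype.card X) ≃ X} {s s' s'' : State}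

/-- Between `s` and `s'`, points have only been added; and either the search was successful, or
some point was added, or the set of marked points satisfies `G`. -/
structure Progress (e : Fin (Fintype.card X) ≃ X) (s s' : State) (G : Set X → Prop) : Prop where
  subset : marked e (s.nat aVis) ⊆ marked e (s'.nat aVis)
  found : s.nat vFound 0 0 ≠ 0 → s'.nat vFound 0 0 ≠ 0
  cases : s'.nat vFound 0 0 ≠ 0 ∨ marked e (s.nat aVis) ≠ marked e (s'.nat aVis) ∨
    G (marked e (s.nat aVis))

theorem Progress.refl {G : Set X → Prop} (h : G (marked e (s.nat aVis))) : Progress e s s G :=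
  ⟨subset_rfl, id, .inr (.inr h)⟩

/-- If no point was added overall, then by monotonicity none was added in either half, so `G` and
`G'` speak of the same marked set. -/
theorem Progress.trans {G G' : Set X → Prop} (h : Progress e s s' G) (h' : Progress e s' s'' G') :
    Progress e s s'' (fun V => G V ∧ G' V) where
  subset := h.subset.trans h'.subset
  found := fun h0 => h'.found (h.found h0)
  cases := by
    rcases h'.cases with h1 | h1 | h1
    · exact .inl h1
    · exact .inr (.inl fun h0 => h1 (h'.subset.antisymm (h0 ▸ h.subset)))
    · rcases h.cases with h2 | h2 | h2
      · exact .inl (h'.found h2)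
      · exact .inr (.inl fun h0 => h2 (h.subset.antisymm (h0 ▸ h'.subset)))
      · by_cases h3 : marked e (s.nat aVis) = marked e (s'.nat aVis)
        · exact .inr (.inr ⟨h2, h3 ▸ h1⟩)
        · exact .inr (.inl fun h0 => h3 (h.subset.antisymm (h0 ▸ h'.subset)))

theorem Progress.mono {G G' : Set X → Prop} (h : Progress e s s' G)
    (hG : G (marked e (s.nat aVis)) → G' (marked e (s.nat aVis))) : Progress e s s' G' :=
  ⟨h.subset, h.found, h.cases.imp id (Or.imp id hG)⟩

theorem Progress.congr_left {G : Set X → Prop} (h : Progress e s s' G)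
    (h5 : s.nat aVis = s''.nat aVis) (h12 : s.nat vFound = s''.nat vFound) :
    Progress e s'' s' G :=
  ⟨h5 ▸ h.subset, h12 ▸ h.found, h5 ▸ h.cases⟩

theorem Progress.congr_right {G : Set X → Prop} (h : Progress e s s' G)
    (h5 : s''.nat aVis = s'.nat aVis) (h12 : s''.nat vFound = s'.nat vFound) :
    Progress e s s'' G :=
  ⟨h5 ▸ h.subset, h12 ▸ h.found, h5 ▸ h12 ▸ h.cases⟩

end Progress

/-! ### The search for an augmenting path -/

section Search

open Set

variable {X : Type*} [Fintype X] [MetricSpace X]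

variable {P : RMCInstance X} {r : ℝ≥0} {e : Fin (Fintype.card X) ≃ X} {s s' s'' : State}
  {T D V : Set X} {φ : X → X} {t x y z : X} {a : ℕ}

/-- The arrays that hold the state of the search. -/
def searchArrays : List ℕ :=
  [aSize, aRep, aVis, aDead, vCenter, vFound, vFoundSrc, vFoundNbr]

/-- The search for an augmenting path from `t` has only marked points which can be reached, and
any recorded pair is the end of an augmenting path. -/
structure Exploring (P : RMCInstance X) (r : ℝ≥0) (e : Fin (Fintype.card X) ≃ X) (T D : Set X)
    (φ : X → X) (t : X) (s : State) : Prop where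
  holds : Holds P r e s T φ
  dead : marked e (s.nat aDead) = D
  center : s.nat vCenter 0 0 = num e t
  reach : ∀ y ∈ marked e (s.nat aVis), ExchangeReach P.M (P.nbhd r) T D φ t y
  found : s.nat vFound 0 0 ≠ 0 → ∃ y x, s.nat vFoundSrc 0 0 = num e y ∧
    s.nat vFoundNbr 0 0 = num e x ∧ ExchangeReach P.M (P.nbhd r) T D φ t y ∧
    x ∈ P.nbhd r y ∧ x ∉ P.M.closure (φ '' T)

theorem Exploring.congr (h : Exploring P r e T D φ t s)
    (hN : ∀ a ∈ searchArrays, s'.nat a = s.nat a) (hR : ∀ a < 4, s'.real a = s.real a) :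
    Exploring P r e T D φ t s' where
  holds := h.holds.congr (hN _ (by decide)) (hN _ (by decide)) hR
  dead := by rw [hN _ (by decide), h.dead]
  center := by rw [hN _ (by decide), h.center]
  reach := by rw [hN _ (by decide)]; exact h.reach
  found := by
    rw [hN vFound (by decide), hN vFoundSrc (by decide), hN vFoundNbr (by decide)]
    exact h.found

theorem Exploring.writeNat (h : Exploring P r e T D φ t s) (ha : a ∉ searchArrays) (i j v : ℕ) :
    Exploring P r e T D φ t (s.writeNat a i j v) :=
  h.congr (fun _ hb => State.writeNat_nat_of_ne fun h' => ha (h' ▸ hb)) fun _ _ => rfl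

/-- The invariant rule for the loops of the search. -/
theorem Exploring.run_forN {O : Set ℕ → Prop} (h : Exploring P r e T D φ t s) {c : ℕ} {p : Cmd}
    (hc : c ∉ searchArrays) (hp : p.writesNat c = false) (G : X → Set X → Prop)
    (hstep : ∀ (st : State) (z : X), Exploring P r e T D φ t st → st.nat c 0 0 = num e z →
      (∀ a, (Cmd.forN c p).writesNat a = false → st.nat a = s.nat a) →
      Exploring P r e T D φ t (p.run O st) ∧ Progress e st (p.run O st) (G z)) :
    Exploring P r e T D φ t ((Cmd.forN c p).run O s) ∧
      Progress e s ((Cmd.forN c p).run O s) (fun V => ∀ z, G z V) := by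
  have hvis : ∀ (st : State) (i : ℕ), (st.writeNat c 0 0 i).nat aVis = st.nat aVis := fun st i =>
    State.writeNat_nat_of_ne fun h' => hc (h' ▸ by decide)
  have hfound : ∀ (st : State) (i : ℕ), (st.writeNat c 0 0 i).nat vFound = st.nat vFound :=
    fun st i => State.writeNat_nat_of_ne fun h' => hc (h' ▸ by decide)
  have key := Cmd.run_forN_induction (O := O) (fun i st => Exploring P r e T D φ t st ∧
    Progress e s st (fun V => ∀ z, num e z < i → G z V)) c p s hp
    ⟨h.writeNat hc _ _ _, (Progress.refl (by simp)).congr_right (hvis _ _) (hfound _ _)⟩ ?_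
  · refine ⟨key.1, key.2.mono fun hG z => hG z ?_⟩
    rw [h.holds.size]
    exact num_lt e z
  · intro i hi st hI hci hN _ _
    rw [h.holds.size] at hi
    obtain ⟨z, rfl⟩ := exists_num e hi
    obtain ⟨h1, h2⟩ := hstep st z hI.1 hci hN
    refine ⟨h1.writeNat hc _ _ _,
      ((hI.2.trans h2).mono ?_).congr_right (hvis _ _) (hfound _ _)⟩
    rintro ⟨hG, hG'⟩ w hw
    rcases Nat.lt_succ_iff_lt_or_eq.1 hw with hw | hw
    · exact hG w hw
    · rw [num_inj] at hw
      exact hw ▸ hG'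

/-- Each new mark is justified by an exchange step from `y` through `x`. The progress predicate
records the converse, that no such step was overlooked. -/
theorem run_grow (h : Exploring P r e T D φ t s) (hx : s.nat vNbr 0 0 = num e x)
    (hy : ExchangeReach P.M (P.nbhd r) T D φ t y) (hxy : x ∈ P.nbhd r y)
    (hcl : x ∈ P.M.closure (φ '' T)) :
    Exploring P r e T D φ t (grow.run (P.oracle e) s) ∧
      Progress e s (grow.run (P.oracle e) s)
        (fun V => ∀ z, z ∈ T → z ∉ D → x ∉ P.M.closure (φ '' (T \ {z})) → z ∈ V) := by
  refine h.run_forN (by decide) (by rfl)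
    (fun z V => z ∈ T → z ∉ D → x ∉ P.M.closure (φ '' (T \ {z})) → z ∈ V) ?_
  intro st z hst hz hN
  have hcounter : (var vTgt).eval st = num e z := hz
  by_cases hzT : z ∈ T
  swap
  · rw [Cmd.run_ite_of_neg (by rwa [holds_isPos, eval_entry, hcounter, hst.holds.rep_ne_zero]),
      Cmd.run_skip]
    exact ⟨hst, .refl fun h' => absurd h' hzT⟩
  rw [Cmd.run_ite_of_pos (by rwa [holds_isPos, eval_entry, hcounter, hst.holds.rep_ne_zero])]
  have hdead : (isPos (entry aDead (var vTgt))).Holds (P.oracle e) st ↔ z ∈ D := by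
    rw [holds_isPos, eval_entry, hcounter, ← hst.dead]
    rfl
  by_cases hzD : z ∈ D
  · rw [Cmd.run_ite_of_pos (hdead.2 hzD), Cmd.run_skip]
    exact ⟨hst, .refl fun _ h' => absurd hzD h'⟩
  rw [Cmd.run_ite_of_neg (fun h' => hzD (hdead.1 h')), Cmd.run_seq, Cmd.run_seq, run_assign,
    hcounter]
  set s₁ := st.writeNat vOmit 0 0 (num e z) with hs₁
  have h₁ : Exploring P r e T D φ t s₁ := hst.writeNat (by decide) _ _ _
  set s₂ := testFree.run (P.oracle e) s₁ with hs₂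
  have h₂ : Exploring P r e T D φ t s₂ :=
    h₁.congr (fun a ha => Cmd.run_nat_eq _ _
      ((by decide : ∀ a ∈ searchArrays, testFree.writesNat a = false) a ha))
      fun a _ => Cmd.run_real_eq _ _ rfl
  have hvis : s₂.nat aVis = st.nat aVis := Cmd.run_nat_eq _ _ rfl
  have hfound : s₂.nat vFound = st.nat vFound := Cmd.run_nat_eq _ _ rfl
  have hfree : (isPos (var vFree)).Holds (P.oracle e) s₂ ↔
      x ∉ P.M.closure (φ '' (T \ {z})) := by
    have h3 := run_testFree h₁.holds (x := x) (by
      rw [hs₁, State.writeNat_nat_of_ne (by norm_num), hN vNbr rfl, hx])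
    have h4 : {w | w ∈ T ∧ num e w ≠ s₁.nat vOmit 0 0} = T \ {z} := by
      ext w
      simp [hs₁, State.writeNat_nat_self, num_inj]
    rw [h4] at h3
    exact holds_isPos.trans h3
  have h2p : Progress e st s₂ (fun _ => True) :=
    (Progress.refl trivial).congr_right hvis hfound
  by_cases hf : x ∉ P.M.closure (φ '' (T \ {z}))
  · rw [Cmd.run_ite_of_pos (hfree.2 hf), run_store]
    have hz2 : (var vTgt).eval s₂ = num e z := by
      rw [eval_var, Cmd.run_nat_eq _ _ rfl, hs₁, State.writeNat_nat_of_ne (by norm_num), hz]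
    rw [hz2, eval_const]
    have hmark := marked_writeNat e (s := s₂) (a := aVis) (x := z) one_ne_zero
    constructor
    · refine ⟨h₂.holds.congr (State.writeNat_nat_of_ne (by norm_num))
        (State.writeNat_nat_of_ne (by norm_num)) fun _ _ => rfl, ?_, ?_, ?_, ?_⟩
      · rw [State.writeNat_nat_of_ne (by norm_num), h₂.dead]
      · rw [State.writeNat_nat_of_ne (by norm_num), h₂.center]
      · rw [hmark]
        rintro w (rfl | hw)
        · exact hy.tail ⟨hzT, hzD, x, hxy, hcl, hf⟩
        · exact h₂.reach w hw
      · rw [State.writeNat_nat_of_ne (by norm_num), State.writeNat_nat_of_ne (by norm_num),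
          State.writeNat_nat_of_ne (by norm_num)]
        exact h₂.found
    · refine ⟨?_, ?_, ?_⟩
      · rw [hmark, hvis]
        exact subset_insert _ _
      · rw [State.writeNat_nat_of_ne (by norm_num), hfound]
        exact id
      · rw [hmark, hvis]
        by_cases hzV : z ∈ marked e (st.nat aVis)
        · exact .inr (.inr fun _ _ _ => hzV)
        · exact .inr (.inl fun h' => hzV (h' ▸ mem_insert _ _))
  · rw [Cmd.run_ite_of_neg (fun h' => hf (hfree.1 h')), Cmd.run_skip]
    exact ⟨h₂, h2p.mono fun _ _ _ h' => absurd h' hf⟩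

/-- The point `x` lies in the span of the representatives, and all centers whose representative
can be exchanged for `x` belong to `V`. -/
def Settled (P : RMCInstance X) (T D : Set X) (φ : X → X) (x : X) (V : Set X) : Prop :=
  x ∈ P.M.closure (φ '' T) ∧
    ∀ z, z ∈ T → z ∉ D → x ∉ P.M.closure (φ '' (T \ {z})) → z ∈ V

/-- A free `x` ends an augmenting path, and a spanned one only leads to exchange steps. A later
success may overwrite an earlier one harmlessly, because `φ` is fixed during the search. -/
theorem run_visit (h : Exploring P r e T D φ t s) (hx : s.nat vNbr 0 0 = num e x)
    (hsrc : s.nat vSrc 0 0 = num e y) (hy : ExchangeReach P.M (P.nbhd r) T D φ t y)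
    (hxy : x ∈ P.nbhd r y) :
    Exploring P r e T D φ t (visit.run (P.oracle e) s) ∧
      Progress e s (visit.run (P.oracle e) s) (Settled P T D φ x) := by
  rw [visit, Cmd.run_seq, Cmd.run_seq, run_assign, eval_var, h.holds.size]
  set s₁ := s.writeNat vOmit 0 0 (Fintype.card X) with hs₁
  have h₁ : Exploring P r e T D φ t s₁ := h.writeNat (by decide) _ _ _
  set s₂ := testFree.run (P.oracle e) s₁ with hs₂
  have h₂ : Exploring P r e T D φ t s₂ :=
    h₁.congr (fun a ha => Cmd.run_nat_eq _ _
      ((by decide : ∀ a ∈ searchArrays, testFree.writesNat a = false) a ha))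
      fun a _ => Cmd.run_real_eq _ _ rfl
  have hvis : s₂.nat aVis = s.nat aVis := Cmd.run_nat_eq _ _ rfl
  have hfound : s₂.nat vFound = s.nat vFound := Cmd.run_nat_eq _ _ rfl
  have hx₁ : s₁.nat vNbr 0 0 = num e x := by
    rw [hs₁, State.writeNat_nat_of_ne (by norm_num), hx]
  have hx₂ : s₂.nat vNbr 0 0 = num e x := by rw [hs₂, Cmd.run_nat_eq _ _ rfl, hx₁]
  have hsrc₂ : s₂.nat vSrc 0 0 = num e y := by
    rw [hs₂, Cmd.run_nat_eq _ _ rfl, hs₁, State.writeNat_nat_of_ne (by norm_num), hsrc]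
  have hfree : (isPos (var vFree)).Holds (P.oracle e) s₂ ↔ x ∉ P.M.closure (φ '' T) := by
    have h3 := run_testFree h₁.holds (x := x) hx₁
    have h4 : {w | w ∈ T ∧ num e w ≠ s₁.nat vOmit 0 0} = T := by
      ext w
      simpa [hs₁, State.writeNat_nat_self] using fun _ => (num_lt e w).ne
    rw [h4] at h3
    exact holds_isPos.trans h3
  by_cases hf : x ∉ P.M.closure (φ '' T)
  · rw [Cmd.run_ite_of_pos (hfree.2 hf), Cmd.run_seq, Cmd.run_seq, run_assign, run_assign,
      run_assign]
    simp only [eval_const, eval_var]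
    rw [State.writeNat_nat_of_ne (by norm_num), State.writeNat_nat_of_ne (by norm_num),
      State.writeNat_nat_of_ne (by norm_num), hx₂, hsrc₂]
    set s₃ := ((s₂.writeNat vFound 0 0 1).writeNat vFoundSrc 0 0 (num e y)).writeNat
      vFoundNbr 0 0 (num e x) with hs₃
    have hN : ∀ a, a ≠ vFound → a ≠ vFoundSrc → a ≠ vFoundNbr → s₃.nat a = s₂.nat a := by
      intro a h1 h2 h3
      rw [hs₃, State.writeNat_nat_of_ne h3, State.writeNat_nat_of_ne h2,
        State.writeNat_nat_of_ne h1]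
    have hfound₃ : s₃.nat vFound 0 0 ≠ 0 := by
      rw [hs₃, State.writeNat_nat_of_ne (by norm_num), State.writeNat_nat_of_ne (by norm_num)]
      simp [State.writeNat_nat_self]
    constructor
    · refine ⟨h₂.holds.congr (hN _ (by norm_num) (by norm_num) (by norm_num))
        (hN _ (by norm_num) (by norm_num) (by norm_num)) fun _ _ => rfl, ?_, ?_, ?_, ?_⟩
      · rw [hN _ (by norm_num) (by norm_num) (by norm_num), h₂.dead]
      · rw [hN _ (by norm_num) (by norm_num) (by norm_num), h₂.center]
      · rw [hN _ (by norm_num) (by norm_num) (by norm_num)]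
        exact h₂.reach
      · refine fun _ => ⟨y, x, ?_, ?_, hy, hxy, hf⟩
        · rw [hs₃, State.writeNat_nat_of_ne (by norm_num)]
          simp [State.writeNat_nat_self]
        · simp [hs₃, State.writeNat_nat_self]
    · refine ⟨?_, fun _ => hfound₃, .inl hfound₃⟩
      rw [hN _ (by norm_num) (by norm_num) (by norm_num), hvis]
  · rw [Cmd.run_ite_of_neg (fun h' => hf (hfree.1 h'))]
    rw [not_not] at hf
    obtain ⟨h3, h4⟩ := run_grow h₂ hx₂ hy hxy hf
    exact ⟨h3, (h4.mono fun h' => ⟨hf, h'⟩).congr_left hvis hfound⟩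

theorem Holds.nbhd_iff (h : Holds P r e s T φ) (O : Set ℕ → Prop) {i j : NatExpr}
    (hi : i.eval s = num e y) (hj : j.eval s = num e x) :
    (Test.realLE (.read rDist i j) (.add Center.radius Center.radius)).Holds O s ↔ x ∈ P.nbhd r y := by
  rw [Test.holds_realLE, RealExpr.eval_read, hi, hj, h.dist, RMCInstance.mem_nbhd,
    RealExpr.eval_add, Center.radius, RealExpr.eval_read, eval_const, h.radius, dist_comm, two_mul]

theorem run_visitAll (h : Exploring P r e T D φ t s) (hsrc : s.nat vSrc 0 0 = num e y)
    (hy : ExchangeReach P.M (P.nbhd r) T D φ t y) :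
    Exploring P r e T D φ t (visitAll.run (P.oracle e) s) ∧
      Progress e s (visitAll.run (P.oracle e) s)
        (fun V => ∀ x, x ∈ P.nbhd r y → Settled P T D φ x V) := by
  refine h.run_forN (by decide) (by rfl) (fun x V => x ∈ P.nbhd r y → Settled P T D φ x V) ?_
  intro st x hst hx hN
  have hsrc' : st.nat vSrc 0 0 = num e y := by rw [hN _ rfl, hsrc]
  have htest := hst.holds.nbhd_iff (P.oracle e) (i := var vSrc) (j := var vNbr) hsrc' hx
  by_cases hxy : x ∈ P.nbhd r y
  · rw [Cmd.run_ite_of_pos (htest.2 hxy)]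
    obtain ⟨h1, h2⟩ := run_visit hst hx hsrc' hy hxy
    exact ⟨h1, h2.mono fun h' _ => h'⟩
  · rw [Cmd.run_ite_of_neg (fun h' => hxy (htest.1 h')), Cmd.run_skip]
    exact ⟨hst, .refl fun h' => absurd h' hxy⟩

theorem run_pass (h : Exploring P r e T D φ t s) :
    Exploring P r e T D φ t (pass.run (P.oracle e) s) ∧
      Progress e s (pass.run (P.oracle e) s)
        (fun V => ∀ y, y ∈ V → ∀ x, x ∈ P.nbhd r y → Settled P T D φ x V) := by
  refine h.run_forN (by decide) (by rfl)
    (fun y V => y ∈ V → ∀ x, x ∈ P.nbhd r y → Settled P T D φ x V) ?_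
  intro st y hst hy hN
  have htest : (isPos (entry aVis (var vSrc))).Holds (P.oracle e) st ↔
      y ∈ marked e (st.nat aVis) := by
    rw [holds_isPos, eval_entry, eval_var, hy, mem_marked]
  by_cases hyV : y ∈ marked e (st.nat aVis)
  · rw [Cmd.run_ite_of_pos (htest.2 hyV)]
    obtain ⟨h1, h2⟩ := run_visitAll hst hy (hst.reach y hyV)
    exact ⟨h1, h2.mono fun h' _ => h'⟩
  · rw [Cmd.run_ite_of_neg (fun h' => hyV (htest.1 h')), Cmd.run_skip]
    exact ⟨hst, .refl fun h' => absurd h' hyV⟩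

/-- `V` is closed under exchange steps and contains `t`, hence contains everything reachable, and
nothing in it has a free neighbour. Stagnation of the search thus proves that no path exists. -/
theorem not_augmentable_of_settled (ht : t ∈ V)
    (hV : ∀ y, y ∈ V → ∀ x, x ∈ P.nbhd r y → Settled P T D φ x V) :
    ¬ Augmentable P.M (P.nbhd r) T D φ t := by
  rintro ⟨y, hy, x, hxy, hx⟩
  have hyV : y ∈ V := by
    clear hx hxy
    induction hy with
    | refl => exact ht
    | tail _ hs ih =>
      obtain ⟨hzT, hzD, w, hw, -, hwz⟩ := hs
      exact (hV _ ih w hw).2 _ hzT hzD hwz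
  exact hx (hV y hyV x hxy).1

theorem run_explore (h : Holds P r e s T φ) (hD : marked e (s.nat aDead) = D)
    (ht : s.nat vCenter 0 0 = num e t) :
    Exploring P r e T D φ t (explore.run (P.oracle e) s) ∧
      ((explore.run (P.oracle e) s).nat vFound 0 0 ≠ 0 ∨
        ¬ Augmentable P.M (P.nbhd r) T D φ t) := by
  rw [explore, Cmd.run_seq, Cmd.run_seq, Cmd.run_seq, run_store, run_assign]
  set s₁ := (clear aVis).run (P.oracle e) s with hs₁
  have hclear : marked e (s₁.nat aVis) = ∅ := run_clear _ (by norm_num) h.size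
  have hcenter₁ : s₁.nat vCenter 0 0 = num e t := by rw [hs₁, Cmd.run_nat_eq _ _ rfl, ht]
  rw [eval_var, hcenter₁, eval_const, eval_const]
  set s₂ := (s₁.writeNat aVis 0 (num e t) 1).writeNat vFound 0 0 0 with hs₂
  have hN : ∀ a, a ≠ aVis → a ≠ vFound → a ≠ vCount → s₂.nat a = s.nat a := by
    intro a h1 h2 h3
    rw [hs₂, State.writeNat_nat_of_ne h2, State.writeNat_nat_of_ne h1, hs₁,
      Cmd.run_nat_eq _ _ (by simp [clear, store, Cmd.writesNat, h1.symm, h3.symm])]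
  have hmark : marked e (s₂.nat aVis) = {t} := by
    rw [hs₂, State.writeNat_nat_of_ne (by norm_num), marked_writeNat e one_ne_zero, hclear]
    simp
  have h₂ : Exploring P r e T D φ t s₂ := by
    refine ⟨h.congr (hN _ (by norm_num) (by norm_num) (by norm_num))
      (hN _ (by norm_num) (by norm_num) (by norm_num)) fun a _ => ?_, ?_, ?_, ?_, ?_⟩
    · rw [hs₂, State.writeNat_real, State.writeNat_real, hs₁, Cmd.run_real_eq _ _ rfl]
    · rw [hN _ (by norm_num) (by norm_num) (by norm_num), hD]
    · rw [hN _ (by norm_num) (by norm_num) (by norm_num), ht]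
    · rw [hmark]
      rintro _ rfl
      exact .refl
    · intro h'
      simp [hs₂, State.writeNat_nat_self] at h'
  -- A pass that neither succeeds nor settles the matter marks a new point. Starting from `{t}`,
  -- more than `i` points are marked after `i` such passes, so `Fintype.card X` passes suffice.
  have key := Cmd.run_forN_induction (O := P.oracle e)
    (fun i st => Exploring P r e T D φ t st ∧ t ∈ marked e (st.nat aVis) ∧
      (st.nat vFound 0 0 ≠ 0 ∨ ¬ Augmentable P.M (P.nbhd r) T D φ t ∨
        i < (marked e (st.nat aVis)).ncard)) vRound pass s₂ rfl ?_ ?_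
  · refine ⟨key.1, key.2.2.imp id (Or.rec id fun h' => ?_)⟩
    rw [h₂.holds.size] at h'
    exact absurd ((ncard_le_card _).trans (Nat.card_eq_fintype_card (α := X)).le) (not_le.2 h')
  · refine ⟨h₂.writeNat (by decide) _ _ _, ?_⟩
    have hvis : (s₂.writeNat vRound 0 0 0).nat aVis = s₂.nat aVis :=
      State.writeNat_nat_of_ne (by norm_num)
    simp [hvis, hmark]
  · rintro i - st ⟨hst, htV, hcases⟩ - - - -
    obtain ⟨h1, h2⟩ := run_pass hst
    refine ⟨h1.writeNat (by decide) _ _ _, ?_⟩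
    rw [State.writeNat_nat_of_ne (by norm_num), State.writeNat_nat_of_ne (by norm_num)]
    refine ⟨h2.subset htV, ?_⟩
    rcases hcases with h3 | h3 | h3
    · exact .inl (h2.found h3)
    · exact .inr (.inl h3)
    · rcases h2.cases with h4 | h4 | h4
      · exact .inl h4
      · refine .inr (.inr ?_)
        have := ncard_lt_ncard (h2.subset.ssubset_of_ne h4) (toFinite _)
        omega
      · exact .inr (.inl (not_augmentable_of_settled htV h4))

end Search

/-! ### Augmentation, selection and the greedy loop on the machine -/

section Greedy

open Set

variable {X : Type*} [Fintype X] [MetricSpace X]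

variable {P : RMCInstance X} {r : ℝ≥0} {e : Fin (Fintype.card X) ≃ X} {s : State}
  {T U : Set X} {φ : X → X} {t x y : X} {i : ℕ}

/-- The invariant of the restarts of the search for an augmenting path from `t`. -/
structure Restarting (P : RMCInstance X) (r : ℝ≥0) (e : Fin (Fintype.card X) ≃ X) (T : Set X)
    (t : X) (i : ℕ) (φ : X → X) (s : State) : Prop where
  holds : Holds P r e s T φ
  center : s.nat vCenter 0 0 = num e t
  dead : marked e (s.nat aDead) ⊆ T
  success : s.nat vFlag 0 0 ≠ 0 →
    ∃ x, s.nat vFoundNbr 0 0 = num e x ∧ x ∈ P.nbhd r t ∧ x ∉ P.M.closure (φ '' T)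
  failure : s.nat vFlag 0 0 = 0 → ¬ P.RelaxIndep r (insert t T) ∨
    (Augmentable P.M (P.nbhd r) T (marked e (s.nat aDead)) φ t ∧
      i ≤ (marked e (s.nat aDead)).ncard)

theorem Restarting.writeNat {a : ℕ} (h : Restarting P r e T t i φ s)
    (ha : a ∉ [aSize, aRep, aDead, vCenter, vFoundNbr, vFlag]) (j k v : ℕ) :
    Restarting P r e T t i φ (s.writeNat a j k v) := by
  simp only [List.mem_cons, List.not_mem_nil, or_false, not_or] at ha
  obtain ⟨h0, h3, h6, h7, h14, h15⟩ := ha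
  have hN : ∀ b, a ≠ b → (s.writeNat a j k v).nat b = s.nat b :=
    fun b hb => State.writeNat_nat_of_ne hb.symm
  refine ⟨h.holds.congr (hN _ h0) (hN _ h3) fun _ _ => rfl, ?_, ?_, ?_, ?_⟩
  · rw [hN _ h7, h.center]
  · rw [hN _ h6]
    exact h.dead
  · rw [hN _ h15, hN _ h14]
    exact h.success
  · rw [hN _ h15, hN _ h6]
    exact h.failure

theorem run_restart (ht : t ∉ T) (h : Restarting P r e T t i φ s) :
    ∃ ψ, Restarting P r e T t (i + 1) ψ (restart.run (P.oracle e) s) := by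
  classical
  rw [restart]
  by_cases hflag : s.nat vFlag 0 0 = 0
  swap
  · rw [Cmd.run_ite_of_pos (by rwa [holds_isPos]), Cmd.run_skip]
    exact ⟨φ, h.holds, h.center, h.dead, h.success, fun h' => absurd h' hflag⟩
  rw [Cmd.run_ite_of_neg (by rwa [holds_isPos, not_not]), Cmd.run_seq]
  obtain ⟨h₁, hfound⟩ := run_explore h.holds rfl h.center
  set s₁ := explore.run (P.oracle e) s with hs₁
  have hdead₁ : s₁.nat aDead = s.nat aDead := Cmd.run_nat_eq _ _ rfl
  have hflag₁ : s₁.nat vFlag 0 0 = 0 := by rw [hs₁, Cmd.run_nat_eq _ _ rfl, hflag]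
  by_cases hf : s₁.nat vFound 0 0 = 0
  · rw [Cmd.run_ite_of_neg (by rwa [holds_isPos, not_not]), Cmd.run_skip]
    refine ⟨φ, h₁.holds, h₁.center, by rw [hdead₁]; exact h.dead,
      fun h' => absurd hflag₁ h', fun _ => .inl ?_⟩
    -- With dead vertices a failed search does not by itself certify dependence. By the invariant,
    -- however, a path avoiding them exists unless dependence is already established.
    exact (h.failure hflag).resolve_right fun h' => (hfound.resolve_left fun h'' => h'' hf) h'.1
  rw [Cmd.run_ite_of_pos (by rwa [holds_isPos])]
  obtain ⟨y, x, hy, hx, hreach, hxy, hxT⟩ := h₁.found hf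
  by_cases hyt : y = t
  · subst hyt
    rw [Cmd.run_ite_of_neg (by rw [holds_differ, eval_var, eval_var, hy, h₁.center]; simp),
      run_assign, eval_const]
    refine ⟨φ, h₁.holds.congr (State.writeNat_nat_of_ne (by norm_num))
      (State.writeNat_nat_of_ne (by norm_num)) fun _ _ => rfl, ?_, ?_, fun _ => ⟨x, ?_, hxy, hxT⟩,
      fun h' => ?_⟩
    · rw [State.writeNat_nat_of_ne (by norm_num), h₁.center]
    · rw [State.writeNat_nat_of_ne (by norm_num), hdead₁]
      exact h.dead
    · rw [State.writeNat_nat_of_ne (by norm_num), hx]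
    · simp [State.writeNat_nat_self] at h'
  rw [Cmd.run_ite_of_pos (by rw [holds_differ, eval_var, eval_var, hy, h₁.center, Ne, num_inj]
                             exact hyt), Cmd.run_seq, run_store, run_store]
  simp only [eval_var, eval_add, eval_const, hx, hy]
  rw [State.writeNat_nat_of_ne (by norm_num), hy]
  obtain ⟨hyT, hyD⟩ := hreach.eq_or_mem.resolve_left hyt
  -- The path ended away from `t`: exchanging at `y` and declaring `y` dead keeps a path alive, and
  -- `y` was not dead before, so the dead set grows strictly.
  obtain ⟨hrep, haug⟩ := h₁.holds.represents.swap P.ground_eq hreach hyt hxy hxT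
  have h₂ := h₁.holds.update (y := y) (x := x) (by rwa [insert_eq_of_mem hyT])
  rw [insert_eq_of_mem hyT] at h₂
  set s₂ := s₁.writeNat aRep 0 (num e y) (num e x + 1) with hs₂
  have hmark : marked e ((s₂.writeNat aDead 0 (num e y) 1).nat aDead) =
      insert y (marked e (s.nat aDead)) := by
    rw [marked_writeNat e one_ne_zero, hs₂, State.writeNat_nat_of_ne (by norm_num), hdead₁]
  refine ⟨_, h₂.congr (State.writeNat_nat_of_ne (by norm_num))
    (State.writeNat_nat_of_ne (by norm_num)) fun _ _ => rfl, ?_, ?_, fun h' => ?_, fun _ => ?_⟩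
  · rw [State.writeNat_nat_of_ne (by norm_num), State.writeNat_nat_of_ne (by norm_num), h₁.center]
  · rw [hmark]
    exact insert_subset hyT h.dead
  · rw [State.writeNat_nat_of_ne (by norm_num), State.writeNat_nat_of_ne (by norm_num)] at h'
    exact absurd hflag₁ h'
  · rw [hmark]
    refine (h.failure hflag).imp id fun h' => ⟨haug, ?_⟩
    rw [ncard_insert_of_notMem hyD (toFinite _)]
    omega

theorem run_augment (h : Holds P r e s T φ) (hc : s.nat vCenter 0 0 = num e t) :
    ∃ ψ, Holds P r e (augment.run (P.oracle e) s) T ψ ∧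
      ((augment.run (P.oracle e) s).nat vFlag 0 0 ≠ 0 →
        ∃ x, (augment.run (P.oracle e) s).nat vFoundNbr 0 0 = num e x ∧
          ∀ [DecidableEq X], Represents P.M (P.nbhd r) (insert t T) (Function.update ψ t x)) ∧
      ((augment.run (P.oracle e) s).nat vFlag 0 0 = 0 → ¬ P.RelaxIndep r (insert t T)) := by
  rw [augment]
  have hent : (entry aRep (var vCenter)).eval s = s.nat aRep 0 (num e t) := by
    rw [eval_entry, eval_var, hc]
  by_cases ht : t ∈ T
  · rw [Cmd.run_ite_of_pos (by rwa [holds_isPos, hent, h.rep_ne_zero]), Cmd.run_seq, run_assign,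
      run_assign]
    simp only [eval_sub, eval_entry, eval_var, eval_const]
    rw [State.writeNat_nat_of_ne (by norm_num), State.writeNat_nat_of_ne (by norm_num), hc,
      h.rep t ht, Nat.add_sub_cancel]
    refine ⟨φ, (h.congr (State.writeNat_nat_of_ne (by norm_num))
      (State.writeNat_nat_of_ne (by norm_num)) fun _ _ => rfl : Holds P r e
        (s.writeNat vFlag 0 0 1) T φ).congr (State.writeNat_nat_of_ne (by norm_num))
      (State.writeNat_nat_of_ne (by norm_num)) fun _ _ => rfl, fun _ => ⟨φ t, ?_, ?_⟩, fun h' => ?_⟩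
    · simp [State.writeNat_nat_self]
    · intro _
      rw [insert_eq_of_mem ht, Function.update_eq_self]
      exact h.represents
    · rw [State.writeNat_nat_of_ne (by norm_num)] at h'
      simp [State.writeNat_nat_self] at h'
  rw [Cmd.run_ite_of_neg (by rwa [holds_isPos, hent, h.rep_ne_zero]), Cmd.run_seq, Cmd.run_seq,
    run_assign, eval_const]
  set s₁ := s.writeNat vFlag 0 0 0 with hs₁
  set s₂ := (clear aDead).run (P.oracle e) s₁ with hs₂
  have hsize : s₁.nat aSize 0 0 = Fintype.card X := by
    rw [hs₁, State.writeNat_nat_of_ne (by norm_num), h.size]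
  have hdead : marked e (s₂.nat aDead) = ∅ := run_clear _ (by norm_num) hsize
  have hflag : s₂.nat vFlag 0 0 = 0 := by
    rw [hs₂, Cmd.run_nat_eq _ _ rfl]
    simp [hs₁, State.writeNat_nat_self]
  have h₂ : Restarting P r e T t 0 φ s₂ := by
    refine ⟨h.congr ?_ ?_ fun a _ => Cmd.run_real_eq _ _ rfl, ?_, by simp [hdead],
      fun h' => absurd hflag h', fun _ => ?_⟩
    · rw [hs₂, Cmd.run_nat_eq _ _ rfl, hs₁, State.writeNat_nat_of_ne (by norm_num)]
    · rw [hs₂, Cmd.run_nat_eq _ _ rfl, hs₁, State.writeNat_nat_of_ne (by norm_num)]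
    · rw [hs₂, Cmd.run_nat_eq _ _ rfl, hs₁, State.writeNat_nat_of_ne (by norm_num), hc]
    · rw [hdead]
      -- Only here, with the empty dead set, is the absence of a path turned into dependence.
      by_cases haug : Augmentable P.M (P.nbhd r) T ∅ φ t
      · exact .inr ⟨haug, Nat.zero_le _⟩
      · exact .inl (h.represents.not_radoIndep_insert ht haug)
  have key := Cmd.run_forN_induction (O := P.oracle e)
    (fun i st => ∃ ψ, Restarting P r e T t i ψ st) vRestart restart s₂ rfl
    ⟨φ, h₂.writeNat (by decide) _ _ _⟩ ?_
  · rw [h₂.holds.size] at key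
    obtain ⟨ψ, hψ⟩ := key
    refine ⟨ψ, hψ.holds, fun hf => ?_, fun hf => ?_⟩
    · obtain ⟨x, hx, hxt, hxT⟩ := hψ.success hf
      refine ⟨x, hx, ?_⟩
      intro _
      rw [← sdiff_singleton_eq_self ht] at hxT
      exact (hψ.holds.represents.mono sdiff_subset).update P.ground_eq hxt hxT
    -- An undecided search would have made `Fintype.card X` points dead, but dead points lie in `T`,
    -- which misses `t`.
    · refine (hψ.failure hf).resolve_right fun h' => ?_
      have h1 := ncard_lt_ncard (hψ.dead.trans_ssubset (ssubset_univ_iff.2 fun hu =>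
        ht (hu ▸ mem_univ t))) (toFinite _)
      rw [ncard_univ, Nat.card_eq_fintype_card] at h1
      omega
  · rintro i - st ⟨ψ, hψ⟩ - - - -
    obtain ⟨χ, hχ⟩ := run_restart ht hψ
    exact ⟨χ, hχ.writeNat (by decide) _ _ _⟩

theorem mem_cover_singleton_iff (h : Holds P r e s T φ) (O : Set ℕ → Prop) {i j : NatExpr}
    (hi : i.eval s = num e y) (hj : j.eval s = num e x) :
    (Test.realLE (.read rDist i j) radius).Holds O s ↔ x ∈ cover {y} r := by
  rw [Test.holds_realLE, RealExpr.eval_read, hi, hj, h.dist, mem_cover_singleton, radius,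
    RealExpr.eval_read, eval_const, h.radius, dist_comm]

theorem run_weigh (h : Holds P r e s T φ) (hc : s.nat vCenter 0 0 = num e t) :
    (weigh.run (P.oracle e) s).real rAcc 0 0 =
      P.weight (cover {t} r ∩ (marked e (s.nat aCov))ᶜ) := by
  classical
  rw [weigh, Cmd.run_seq, Cmd.run_setReal]
  simp only [eval_const, RealExpr.eval_zero]
  set s₁ := s.writeReal rAcc 0 0 0 with hs₁
  have h₁ : Holds P r e s₁ T φ :=
    h.congr rfl rfl fun a ha => State.writeReal_real_of_ne (by omega)
  set S := cover {t} r ∩ (marked e (s.nat aCov))ᶜ with hS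
  have key := Cmd.run_forN_induction (O := P.oracle e)
    (fun i st => st.real rAcc 0 0 = ∑ x with num e x < i, S.indicator (fun x => (P.w x : ℝ)) x)
    vCount (.ite (.realLE (.read rDist (var vCenter) (var vCount)) radius)
      (.ite (isPos (entry aCov (var vCount))) .skip
        (.setReal rAcc (.const 0) (.const 0) (.add (.read rAcc (.const 0) (.const 0))
          (.read rWeight (.const 0) (var vCount))))) .skip) s₁ rfl ?_ ?_
  · refine key.trans ?_
    rw [h₁.size, Finset.filter_true_of_mem fun x _ => num_lt e x, RMCInstance.weight]
    push_cast
    refine Finset.sum_congr rfl fun x _ => ?_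
    by_cases hx : x ∈ S <;> simp [hx]
  · simp [hs₁, State.writeReal_real_self]
  · intro i hi st hI hcount hN hR _
    rw [h₁.size] at hi
    obtain ⟨x, rfl⟩ := exists_num e hi
    have hst : Holds P r e st T φ := h₁.congr (hN _ rfl) (hN _ rfl) fun a ha =>
      hR a (by interval_cases a <;> rfl)
    have hball := mem_cover_singleton_iff hst (P.oracle e) (i := var vCenter) (j := var vCount)
      (y := t) (x := x) (by rw [eval_var, hN _ rfl]; exact hc) hcount
    have hcov : (isPos (entry aCov (var vCount))).Holds (P.oracle e) st ↔
        x ∈ marked e (s.nat aCov) := by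
      rw [holds_isPos, eval_entry, eval_var, hcount, hN _ rfl]
      rfl
    have hsum : ∑ y with num e y < num e x + 1, S.indicator (fun x => (P.w x : ℝ)) y =
        (∑ y with num e y < num e x, S.indicator (fun x => (P.w x : ℝ)) y) +
          S.indicator (fun x => (P.w x : ℝ)) x := by
      have : Finset.univ.filter (fun y => num e y < num e x + 1) =
          insert x (Finset.univ.filter fun y => num e y < num e x) := by
        ext y
        simp only [Finset.mem_filter, Finset.mem_univ, true_and, Finset.mem_insert,
          Nat.lt_succ_iff_lt_or_eq, num_inj]
        exact or_comm
      rw [this, Finset.sum_insert (by simp), add_comm]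
    rw [State.writeNat_real, hsum, ← hI]
    by_cases hx : x ∈ cover {t} r
    · rw [Cmd.run_ite_of_pos (hball.2 hx)]
      by_cases hxc : x ∈ marked e (s.nat aCov)
      · rw [Cmd.run_ite_of_pos (hcov.2 hxc), Cmd.run_skip,
          indicator_of_notMem (fun h' => h'.2 hxc), add_zero]
      · rw [Cmd.run_ite_of_neg (fun h' => hxc (hcov.1 h')), Cmd.run_setReal,
          indicator_of_mem (show x ∈ S from ⟨hx, hxc⟩)]
        simp [State.writeReal_real_self, hcount, hst.weight]
    · rw [Cmd.run_ite_of_neg (fun h' => hx (hball.1 h')), Cmd.run_skip,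
        indicator_of_notMem (fun h' => hx h'.1), add_zero]

/-- The best candidate among the points with number less than `i` has been recorded. -/
structure Selecting (P : RMCInstance X) (r : ℝ≥0) (e : Fin (Fintype.card X) ≃ X) (T U : Set X)
    (i : ℕ) (s : State) : Prop where
  holds : ∃ φ, Holds P r e s T φ
  none : s.nat vBest 0 0 = 0 → ∀ y, num e y < i → ¬ P.RelaxIndep r (insert y T)
  best : s.nat vBest 0 0 ≠ 0 → ∃ b, s.nat vBest 0 0 = num e b + 1 ∧
    P.RelaxIndep r (insert b T) ∧ s.real rBest 0 0 = P.weight (cover {b} r ∩ U) ∧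
    ∀ y, num e y < i → P.RelaxIndep r (insert y T) →
      P.weight (cover {y} r ∩ U) ≤ P.weight (cover {b} r ∩ U)

theorem Selecting.writeNat {a : ℕ} (h : Selecting P r e T U i s)
    (ha : a ∉ [aSize, aRep, vBest]) (j k v : ℕ) :
    Selecting P r e T U i (s.writeNat a j k v) := by
  simp only [List.mem_cons, List.not_mem_nil, or_false, not_or] at ha
  have hN : ∀ b, a ≠ b → (s.writeNat a j k v).nat b = s.nat b :=
    fun b hb => State.writeNat_nat_of_ne hb.symm
  obtain ⟨φ, hφ⟩ := h.holds
  refine ⟨⟨φ, hφ.congr (hN _ ha.1) (hN _ ha.2.1) fun _ _ => rfl⟩, ?_, ?_⟩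
  · rw [hN _ ha.2.2]
    exact h.none
  · rw [hN _ ha.2.2]
    exact h.best

theorem run_record (h : Holds P r e s T φ) (hc : s.nat vCenter 0 0 = num e t)
    (ht : P.RelaxIndep r (insert t T)) (hacc : s.real rAcc 0 0 = P.weight (cover {t} r ∩ U))
    (hmax : ∀ y, num e y < i → P.RelaxIndep r (insert y T) →
      P.weight (cover {y} r ∩ U) ≤ P.weight (cover {t} r ∩ U)) (O : Set ℕ → Prop) :
    Selecting P r e T U i (record.run O s) := by
  rw [record, Cmd.run_seq, run_assign, Cmd.run_setReal]
  simp only [eval_add, eval_var, eval_const, RealExpr.eval_read, State.writeNat_real, hc, hacc]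
  have hN : ∀ a ≠ vBest, ((s.writeNat vBest 0 0 (num e t + 1)).writeReal rBest 0 0
      (P.weight (cover {t} r ∩ U))).nat a = s.nat a := fun a ha => State.writeNat_nat_of_ne ha
  refine ⟨⟨φ, h.congr (hN _ (by norm_num)) (hN _ (by norm_num))
    fun a ha => State.writeReal_real_of_ne (by omega)⟩, fun h' => ?_, fun _ => ⟨t, ?_, ht, ?_, hmax⟩⟩
  · simp [State.writeNat_nat_self] at h'
  · simp [State.writeNat_nat_self]
  · simp [State.writeReal_real_self]

theorem run_compare (h : Selecting P r e T (marked e (s.nat aCov))ᶜ (num e t) s)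
    (hc : s.nat vCenter 0 0 = num e t) (ht : P.RelaxIndep r (insert t T)) :
    Selecting P r e T (marked e (s.nat aCov))ᶜ (num e t + 1) (compare.run (P.oracle e) s) := by
  obtain ⟨φ, hφ⟩ := h.holds
  rw [compare, Cmd.run_seq]
  have hacc := run_weigh hφ hc
  set s₁ := weigh.run (P.oracle e) s with hs₁
  have h₁ : Holds P r e s₁ T φ := hφ.congr (Cmd.run_nat_eq _ _ rfl) (Cmd.run_nat_eq _ _ rfl)
    fun a ha => Cmd.run_real_eq _ _ (by interval_cases a <;> rfl)
  have hbest : s₁.nat vBest = s.nat vBest := Cmd.run_nat_eq _ _ rfl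
  have hreal : s₁.real rBest = s.real rBest := Cmd.run_real_eq _ _ rfl
  have hc₁ : s₁.nat vCenter 0 0 = num e t := by rw [hs₁, Cmd.run_nat_eq _ _ rfl, hc]
  by_cases hb : s.nat vBest 0 0 = 0
  · rw [Cmd.run_ite_of_neg (by rwa [holds_isPos, eval_var, hbest, not_not])]
    refine run_record h₁ hc₁ ht hacc (fun y hy hyT => ?_) _
    rcases Nat.lt_succ_iff_lt_or_eq.1 hy with hy | hy
    · exact absurd hyT (h.none hb y hy)
    · rw [(num_inj e).1 hy]
  · rw [Cmd.run_ite_of_pos (by rwa [holds_isPos, eval_var, hbest])]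
    obtain ⟨b, hb₁, hb₂, hb₃, hb₄⟩ := h.best hb
    have htest : (Test.realLE (.read rAcc (.const 0) (.const 0))
        (.read rBest (.const 0) (.const 0))).Holds (P.oracle e) s₁ ↔
        P.weight (cover {t} r ∩ (marked e (s.nat aCov))ᶜ) ≤
          P.weight (cover {b} r ∩ (marked e (s.nat aCov))ᶜ) := by
      rw [Test.holds_realLE, RealExpr.eval_read, RealExpr.eval_read, eval_const, hacc, hreal, hb₃,
        NNReal.coe_le_coe]
    by_cases hle : P.weight (cover {t} r ∩ (marked e (s.nat aCov))ᶜ) ≤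
        P.weight (cover {b} r ∩ (marked e (s.nat aCov))ᶜ)
    · rw [Cmd.run_ite_of_pos (htest.2 hle), Cmd.run_skip]
      refine ⟨⟨φ, h₁⟩, fun h' => absurd (hbest ▸ h') hb, fun _ => ⟨b, by rw [hbest, hb₁], hb₂,
        by rw [hreal, hb₃], fun y hy hyT => ?_⟩⟩
      rcases Nat.lt_succ_iff_lt_or_eq.1 hy with hy | hy
      · exact hb₄ y hy hyT
      · rwa [(num_inj e).1 hy]
    · rw [Cmd.run_ite_of_neg (fun h' => hle (htest.1 h'))]
      refine run_record h₁ hc₁ ht hacc (fun y hy hyT => ?_) _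
      rcases Nat.lt_succ_iff_lt_or_eq.1 hy with hy | hy
      · exact (hb₄ y hy hyT).trans (not_le.1 hle).le
      · rw [(num_inj e).1 hy]

/-- Testing a candidate may move representatives, so `Selecting` leaves `φ` existential. Feasibility
and gain depend only on `T` and the uncovered set, which stay fixed. -/
theorem run_select (h : Holds P r e s T φ) :
    Selecting P r e T (marked e (s.nat aCov))ᶜ (Fintype.card X) (select.run (P.oracle e) s) := by
  rw [select, Cmd.run_seq, run_assign, eval_const]
  set s₁ := s.writeNat vBest 0 0 0 with hs₁
  have h₁ : Holds P r e s₁ T φ := h.congr (State.writeNat_nat_of_ne (by norm_num))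
    (State.writeNat_nat_of_ne (by norm_num)) fun _ _ => rfl
  have hcov₁ : s₁.nat aCov = s.nat aCov := State.writeNat_nat_of_ne (by norm_num)
  have hbest₁ : s₁.nat vBest 0 0 = 0 := by simp [hs₁, State.writeNat_nat_self]
  have key := Cmd.run_forN_induction (O := P.oracle e)
    (Selecting P r e T (marked e (s.nat aCov))ᶜ) vCand
    (.seq (assign vCenter (var vCand)) (.seq augment
      (.ite (isPos (var vFlag)) compare .skip))) s₁ rfl ?_ ?_
  · rwa [h₁.size] at key
  · refine Selecting.writeNat ⟨⟨φ, h₁⟩, fun _ y hy => absurd hy (Nat.not_lt_zero _),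
      fun h' => absurd hbest₁ h'⟩ (by decide) _ _ _
  · intro i hi st hI hcand hN hR _
    rw [h₁.size] at hi
    obtain ⟨t, rfl⟩ := exists_num e hi
    refine Selecting.writeNat ?_ (by decide) _ _ _
    rw [Cmd.run_seq, Cmd.run_seq, run_assign, eval_var, hcand]
    have h₂ := hI.writeNat (a := vCenter) (by decide) 0 0 (num e t)
    have hc₂ : (st.writeNat vCenter 0 0 (num e t)).nat vCenter 0 0 = num e t := by
      simp [State.writeNat_nat_self]
    have hcov₂ : (st.writeNat vCenter 0 0 (num e t)).nat aCov = s.nat aCov := by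
      rw [State.writeNat_nat_of_ne (by norm_num), hN _ rfl, hcov₁]
    set s₂ := st.writeNat vCenter 0 0 (num e t)
    obtain ⟨φ₂, hφ₂⟩ := h₂.holds
    obtain ⟨ψ, hψ, hsucc, hfail⟩ := run_augment hφ₂ hc₂
    set s₃ := augment.run (P.oracle e) s₂ with hs₃
    have hc₃ : s₃.nat vCenter 0 0 = num e t := by rw [hs₃, Cmd.run_nat_eq _ _ rfl, hc₂]
    have hcov₃ : s₃.nat aCov = s.nat aCov := by rw [hs₃, Cmd.run_nat_eq _ _ rfl, hcov₂]
    have hbest₃ : s₃.nat vBest = s₂.nat vBest := Cmd.run_nat_eq _ _ rfl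
    have hreal₃ : s₃.real rBest = s₂.real rBest := Cmd.run_real_eq _ _ rfl
    have h₃ : Selecting P r e T (marked e (s.nat aCov))ᶜ (num e t) s₃ :=
      ⟨⟨ψ, hψ⟩, by rw [hbest₃]; exact h₂.none, by rw [hbest₃, hreal₃]; exact h₂.best⟩
    by_cases hflag : s₃.nat vFlag 0 0 = 0
    · rw [Cmd.run_ite_of_neg (by rwa [holds_isPos, not_not]), Cmd.run_skip]
      refine ⟨h₃.holds, fun hb y hy => ?_, fun hb => ?_⟩
      · rcases Nat.lt_succ_iff_lt_or_eq.1 hy with hy | hy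
        · exact h₃.none hb y hy
        · rw [(num_inj e).1 hy]
          exact hfail hflag
      · obtain ⟨b, hb₁, hb₂, hb₃, hb₄⟩ := h₃.best hb
        refine ⟨b, hb₁, hb₂, hb₃, fun y hy hyT => ?_⟩
        rcases Nat.lt_succ_iff_lt_or_eq.1 hy with hy | hy
        · exact hb₄ y hy hyT
        · rw [(num_inj e).1 hy] at hyT
          exact absurd hyT (hfail hflag)
    · rw [Cmd.run_ite_of_pos (by rwa [holds_isPos])]
      classical
      obtain ⟨x, -, hx⟩ := hsucc hflag
      rw [← hcov₃] at h₃ ⊢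
      exact run_compare h₃ hc₃ hx.radoIndep

theorem run_markCovered (h : Holds P r e s T φ) (hc : s.nat vCenter 0 0 = num e t)
    (O : Set ℕ → Prop) :
    marked e ((markCovered.run O s).nat aCov) = marked e (s.nat aCov) ∪ cover {t} (3 * r) := by
  have key := Cmd.run_forN_induction (O := O)
    (fun i st => marked e (st.nat aCov) =
      marked e (s.nat aCov) ∪ {x | x ∈ cover {t} (3 * r) ∧ num e x < i})
    vCount (.ite (.realLE (.read rDist (var vCenter) (var vCount))
      (.add radius (.add radius radius))) (store aCov (var vCount) (.const 1)) .skip) s rfl ?_ ?_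
  · refine key.trans ?_
    congr 1
    ext x
    simp [h.size, num_lt]
  · rw [State.writeNat_nat_of_ne (by norm_num)]
    simp
  · intro i hi st hI hcount hN hR _
    rw [h.size] at hi
    obtain ⟨x, rfl⟩ := exists_num e hi
    have hst : Holds P r e st T φ := h.congr (hN _ rfl) (hN _ rfl) fun a _ => hR a rfl
    have htest : (Test.realLE (.read rDist (var vCenter) (var vCount))
        (.add radius (.add radius radius))).Holds O st ↔ x ∈ cover {t} (3 * r) := by
      rw [Test.holds_realLE, RealExpr.eval_read, eval_var, eval_var, hcount, hN _ rfl, hc,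
        hst.dist, mem_cover_singleton, dist_comm]
      simp only [radius, RealExpr.eval_add, RealExpr.eval_read, eval_const, hst.radius]
      push_cast
      rw [show (3 : ℝ) * r = r + (r + r) by ring]
    rw [State.writeNat_nat_of_ne (by norm_num)]
    have hlt : ∀ y, num e y < num e x + 1 ↔ num e y < num e x ∨ y = x := fun y => by
      rw [Nat.lt_succ_iff_lt_or_eq, num_inj]
    by_cases hx : x ∈ cover {t} (3 * r)
    · rw [Cmd.run_ite_of_pos (htest.2 hx), run_store, eval_var, hcount, eval_const,
        marked_writeNat e one_ne_zero, hI]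
      ext y
      simp only [mem_insert_iff, mem_union, mem_ofPred_eq, hlt]
      by_cases hy : y = x
      · subst hy
        simp [hx]
      · simp [hy]
    · rw [Cmd.run_ite_of_neg (fun h' => hx (htest.1 h')), Cmd.run_skip, hI]
      ext y
      simp only [mem_union, mem_ofPred_eq, hlt]
      by_cases hy : y = x
      · subst hy
        simp [hx]
      · simp [hy]

/-- The winner is augmented a second time, because testing later candidates may have moved the
representatives and overwritten its free neighbour. That a winner exists is
`GreedyRun.exists_choice`. -/
theorem run_greedyStep (h : Holds P r e s T φ)
    (hrun : P.GreedyRun r i T (marked e (s.nat aCov))ᶜ) (hi : i < P.rank) :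
    ∃ T' ψ, Holds P r e (greedyStep.run (P.oracle e) s) T' ψ ∧
      P.GreedyRun r (i + 1) T' (marked e ((greedyStep.run (P.oracle e) s).nat aCov))ᶜ := by
  classical
  rw [greedyStep, Cmd.run_seq, Cmd.run_seq, Cmd.run_seq, Cmd.run_seq]
  have h₁ := run_select h
  set s₁ := select.run (P.oracle e) s with hs₁
  obtain ⟨t₀, ht₀, -⟩ := hrun.exists_choice hi
  rw [union_singleton] at ht₀
  obtain ⟨t, ht₁, ht₂, -, ht₃⟩ := h₁.best fun h' => h₁.none h' t₀ (num_lt e t₀) ht₀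
  rw [run_assign, eval_sub, eval_var, ht₁, eval_const, Nat.add_sub_cancel]
  set s₂ := s₁.writeNat vCenter 0 0 (num e t) with hs₂
  obtain ⟨φ₁, hφ₁⟩ := h₁.holds
  have h₂ : Holds P r e s₂ T φ₁ := hφ₁.congr (State.writeNat_nat_of_ne (by norm_num))
    (State.writeNat_nat_of_ne (by norm_num)) fun _ _ => rfl
  have hc₂ : s₂.nat vCenter 0 0 = num e t := by simp [hs₂, State.writeNat_nat_self]
  obtain ⟨φ₃, h₃, hsucc, hfail⟩ := run_augment h₂ hc₂
  set s₃ := augment.run (P.oracle e) s₂ with hs₃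
  have hc₃ : s₃.nat vCenter 0 0 = num e t := by rw [hs₃, Cmd.run_nat_eq _ _ rfl, hc₂]
  obtain ⟨x, hx, hrep⟩ := hsucc fun h' => hfail h' ht₂
  rw [run_store, eval_var, hc₃, eval_add, eval_var, hx, eval_const]
  have h₄ := h₃.update hrep
  set s₄ := s₃.writeNat aRep 0 (num e t) (num e x + 1) with hs₄
  have hc₄ : s₄.nat vCenter 0 0 = num e t := by
    rw [hs₄, State.writeNat_nat_of_ne (by norm_num), hc₃]
  refine ⟨_, _, h₄.congr (Cmd.run_nat_eq _ _ rfl) (Cmd.run_nat_eq _ _ rfl)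
    fun a _ => Cmd.run_real_eq _ _ rfl, ?_⟩
  have hcov : s₄.nat aCov = s.nat aCov := by
    rw [hs₄, State.writeNat_nat_of_ne (by norm_num), hs₃, Cmd.run_nat_eq _ _ rfl, hs₂,
      State.writeNat_nat_of_ne (by norm_num), hs₁, Cmd.run_nat_eq _ _ rfl]
  rw [run_markCovered h₄ hc₄, compl_union, hcov, ← union_singleton, ← sdiff_eq]
  refine .step hrun ⟨?_, fun t' ht' => ?_⟩
  · rwa [union_singleton]
  · rw [union_singleton] at ht'
    exact ht₃ t' (num_lt e t') ht'

/-- A rejected point stays rejected as the set grows, since supersets of dependent sets are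
dependent; hence one scan yields a maximal independent set. -/
theorem run_findBase (hn : s.nat aSize 0 0 = Fintype.card X)
    (hbase : ∀ x, s.nat aBase 0 (num e x) = 0) :
    P.M.IsBase (marked e ((findBase.run (P.oracle e) s).nat aBase)) := by
  have key := Cmd.run_forN_induction (O := P.oracle e)
    (fun i st => P.M.Indep (marked e (st.nat aBase)) ∧
      (∀ x, num e x < i → x ∉ marked e (st.nat aBase) →
        ¬ P.M.Indep (insert x (marked e (st.nat aBase)))) ∧
      ∀ x, i ≤ num e x → st.nat aBase 0 (num e x) = 0)
    vMain (.seq (store aBase (var vMain) (.const 1))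
    (.ite (.indep aBase (.const 0)) .skip (store aBase (var vMain) (.const 0)))) s rfl ?_ ?_
  · rw [hn] at key
    rw [Matroid.isBase_iff_maximal_indep, maximal_iff_forall_insert fun _ _ h h' => h.subset h']
    exact ⟨key.1, fun x hx => key.2.1 x (num_lt e x) hx⟩
  · rw [State.writeNat_nat_of_ne (by norm_num)]
    have : marked e (s.nat aBase) = ∅ := by
      ext x
      simp [mem_marked, hbase]
    rw [this]
    exact ⟨P.M.empty_indep, fun x hx => absurd hx (Nat.not_lt_zero _), fun x _ => hbase x⟩
  · rintro i hi st ⟨hI₁, hI₂, hI₃⟩ hcount hN - -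
    rw [hn] at hi
    obtain ⟨x, rfl⟩ := exists_num e hi
    rw [State.writeNat_nat_of_ne (by norm_num), Cmd.run_seq, run_store, eval_var, hcount,
      eval_const]
    set s₁ := st.writeNat aBase 0 (num e x) 1 with hs₁
    have hmark : marked e (s₁.nat aBase) = insert x (marked e (st.nat aBase)) :=
      marked_writeNat e one_ne_zero
    have htest : (Test.indep aBase (.const 0)).Holds (P.oracle e) s₁ ↔
        P.M.Indep (insert x (marked e (st.nat aBase))) := by
      rw [Test.holds_indep, eval_const, oracle_iff, hmark]
    by_cases hind : P.M.Indep (insert x (marked e (st.nat aBase)))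
    · rw [Cmd.run_ite_of_pos (htest.2 hind), Cmd.run_skip, hmark]
      refine ⟨hind, fun y hy hyB hyI => ?_, fun y hy => ?_⟩
      · rw [mem_insert_iff, not_or] at hyB
        rcases Nat.lt_succ_iff_lt_or_eq.1 hy with hy | hy
        · exact hI₂ y hy hyB.2 (hyI.subset (insert_subset_insert (subset_insert _ _)))
        · exact hyB.1 ((num_inj e).1 hy)
      · rw [hs₁, State.writeNat_nat_self, if_neg (by omega)]
        exact hI₃ y (by omega)
    · have hx₁ : (var vMain).eval s₁ = num e x := by
        rw [eval_var, hs₁, State.writeNat_nat_of_ne (by norm_num), hcount]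
      rw [Cmd.run_ite_of_neg (fun h' => hind (htest.1 h')), run_store, hx₁, eval_const]
      -- Writing zero restores the old entry, because entries from the counter onwards were still
      -- zero.
      have hent : ∀ j, (s₁.writeNat aBase 0 (num e x) 0).nat aBase 0 j = st.nat aBase 0 j := by
        intro j
        simp only [State.writeNat_nat_self, hs₁, true_and]
        split_ifs with hj
        · rw [hj, hI₃ x le_rfl]
        · rfl
      have hmark' : marked e ((s₁.writeNat aBase 0 (num e x) 0).nat aBase) =
          marked e (st.nat aBase) := by
        ext y
        rw [mem_marked, mem_marked, hent]
      rw [hmark']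
      refine ⟨hI₁, fun y hy hyB => ?_, fun y hy => ?_⟩
      · rcases Nat.lt_succ_iff_lt_or_eq.1 hy with hy | hy
        · exact hI₂ y hy hyB
        · rwa [(num_inj e).1 hy]
      · rw [hent]
        exact hI₃ y (by omega)

theorem holds_input (P : RMCInstance X) (r : ℝ≥0) (e : Fin (Fintype.card X) ≃ X) :
    Holds P r e (P.input r e) ∅ id where
  size := by simp [RMCInstance.input]
  dist x y := by
    simp only [RMCInstance.input, if_true]
    rw [dif_pos ⟨num_lt e x, num_lt e y⟩]
    simp [num]
  weight x := by
    simp only [RMCInstance.input, one_ne_zero, if_false, and_self, if_true]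
    rw [dif_pos (num_lt e x)]
    simp [num]
  radius := by simp [RMCInstance.input]
  rep x hx := absurd hx (notMem_empty x)
  rep_of_notMem x _ := by simp [RMCInstance.input]
  represents := RMCInstance.represents_id P.M.empty_indep

/-- The rank is never computed as a number: the main loop scans all points and performs one greedy
round for each element of the base `B`, so the number of rounds done is the number of base elements
passed. -/
theorem run_main (P : RMCInstance X) (r : ℝ≥0) (e : Fin (Fintype.card X) ≃ X) :
    P.IsGreedyOutput r ((main.run (P.oracle e) (P.input r e)).output e) := by
  rw [main, Cmd.run_seq, Cmd.run_seq, Cmd.run_seq, run_assign]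
  have h₀ := holds_input P r e
  have hbase := run_findBase (P := P) (e := e) h₀.size fun x => by simp [RMCInstance.input]
  set s₁ := findBase.run (P.oracle e) (P.input r e) with hs₁
  set B := marked e (s₁.nat aBase) with hB
  have h₁ : Holds P r e s₁ ∅ id := h₀.congr (Cmd.run_nat_eq _ _ rfl) (Cmd.run_nat_eq _ _ rfl)
    fun a _ => Cmd.run_real_eq _ _ rfl
  have hrank : B.ncard = P.rank := by
    rw [ncard_def, RMCInstance.rank, hbase.encard_eq_eRank]
  have key := Cmd.run_forN_induction (O := P.oracle e)
    (fun i st => ∃ T φ, Holds P r e st T φ ∧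
      P.GreedyRun r {x | x ∈ B ∧ num e x < i}.ncard T (marked e (st.nat aCov))ᶜ)
    vMain (.ite (isPos (entry aBase (var vMain))) greedyStep .skip) s₁ rfl ?_ ?_
  · set s₂ := (Cmd.forN vMain (.ite (isPos (entry aBase (var vMain))) greedyStep .skip)).run
      (P.oracle e) s₁
    obtain ⟨T, φ, h₂, hrun⟩ := key
    have hB' : {x | x ∈ B ∧ num e x < s₁.nat aSize 0 0} = B := by
      ext x
      simp [h₁.size, num_lt]
    rw [hB', hrank] at hrun
    refine ⟨T, _, hrun, ?_⟩
    rw [eval_var, h₂.size]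
    set s₃ := s₂.writeNat vOmit 0 0 (Fintype.card X) with hs₃
    have h₃ : Holds P r e s₃ T φ := h₂.congr (State.writeNat_nat_of_ne (by norm_num))
      (State.writeNat_nat_of_ne (by norm_num)) fun _ _ => rfl
    have hout : (fill.run (P.oracle e) s₃).output e = φ '' T := by
      refine (run_fill (P.oracle e) h₃).trans ?_
      congr 1
      ext x
      simpa [hs₃, State.writeNat_nat_self] using fun _ => (num_lt e x).ne
    rw [hout]
    exact h₂.represents.isSDR
  · refine ⟨∅, id, h₁.congr (State.writeNat_nat_of_ne (by norm_num))
      (State.writeNat_nat_of_ne (by norm_num)) fun _ _ => rfl, ?_⟩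
    have hcov : marked e ((s₁.writeNat vMain 0 0 0).nat aCov) = ∅ := by
      rw [State.writeNat_nat_of_ne (by norm_num), hs₁, Cmd.run_nat_eq _ _ rfl]
      ext x
      simp [mem_marked, RMCInstance.input]
    rw [hcov, compl_empty]
    simpa using RMCInstance.GreedyRun.init
  · rintro i hi st ⟨T, φ, hst, hrun⟩ hcount hN - -
    rw [h₁.size] at hi
    obtain ⟨x, rfl⟩ := exists_num e hi
    have htest : (isPos (entry aBase (var vMain))).Holds (P.oracle e) st ↔ x ∈ B := by
      rw [holds_isPos, eval_entry, eval_var, hcount, hN _ rfl]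
      rfl
    have hN' : ∀ (st : State) (i : ℕ), (∀ T φ, Holds P r e st T φ →
        Holds P r e (st.writeNat vMain 0 0 i) T φ) ∧
        (st.writeNat vMain 0 0 i).nat aCov = st.nat aCov := fun st i =>
      ⟨fun T φ h => h.congr (State.writeNat_nat_of_ne (by norm_num))
        (State.writeNat_nat_of_ne (by norm_num)) fun _ _ => rfl,
        State.writeNat_nat_of_ne (by norm_num)⟩
    by_cases hx : x ∈ B
    · rw [Cmd.run_ite_of_pos (htest.2 hx), (hN' _ _).2]
      have hins : {y | y ∈ B ∧ num e y < num e x + 1} =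
          insert x {y | y ∈ B ∧ num e y < num e x} := by
        ext y
        simp only [mem_ofPred_eq, mem_insert_iff, Nat.lt_succ_iff_lt_or_eq, num_inj]
        by_cases hy : y = x
        · subst hy
          simp [hx]
        · simp [hy]
      have hnot : x ∉ {y | y ∈ B ∧ num e y < num e x} := fun h' => lt_irrefl _ h'.2
      rw [hins, ncard_insert_of_notMem hnot (toFinite _)]
      have hlt : {y | y ∈ B ∧ num e y < num e x}.ncard < P.rank := by
        rw [← hrank]
        exact ncard_lt_ncard ⟨fun y hy => hy.1, fun h' => hnot (h' hx)⟩ (toFinite _)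
      obtain ⟨T', ψ, h', hrun'⟩ := run_greedyStep hst hrun hlt
      exact ⟨T', ψ, (hN' _ _).1 _ _ h', hrun'⟩
    · rw [Cmd.run_ite_of_neg (fun h' => hx (htest.1 h')), Cmd.run_skip, (hN' _ _).2]
      have hsame : {y | y ∈ B ∧ num e y < num e x + 1} = {y | y ∈ B ∧ num e y < num e x} := by
        ext y
        simp only [mem_ofPred_eq, Nat.lt_succ_iff_lt_or_eq, num_inj]
        by_cases hy : y = x
        · subst hy
          simp [hx]
        · simp [hy]
      rw [hsame]
      exact ⟨T, φ, (hN' _ _).1 _ _ hst, hrun⟩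

end Greedy

end Center

end OracleRAM

theorem theorem2 :
    -- there is one program with a polynomial bound on its number of steps which, on every instance
    -- and for every guess `r`, halts with a possible output of the greedy algorithm, and with a
    -- solution of radius `5r` if there is a solution of radius `r`
    (∃ (prog : OracleRAM.Program) (p : Polynomial ℕ),
      ∀ (X : Type u) [Fintype X] [MetricSpace X] (P : RMCInstance X) (r : ℝ≥0)
        (e : Fin (Fintype.card X) ≃ X),
        ∃ (s : OracleRAM.State) (k : ℕ),
          OracleRAM.Exec (P.oracle e) prog (P.input r e) s k ∧
          k ≤ p.eval (Fintype.card X) ∧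
          P.IsGreedyOutput r (s.output e) ∧
          ((∃ C : Set X, P.IsSolution r C) → P.IsSolution (5 * r) (s.output e))) ∧
    -- the greedy algorithm never gets stuck, and each of its possible outputs, however ties are
    -- broken and representatives are chosen, has the guarantee
    (∀ (X : Type u) [Fintype X] [MetricSpace X] (P : RMCInstance X) (r : ℝ≥0),
      (∀ (i : ℕ) (T U : Set X), i < P.rank → P.GreedyRun r i T U →
        ∃ t : X, P.IsGreedyChoice r T U t) ∧
      (∀ T U : Set X, P.GreedyRun r P.rank T U → ∃ R : Set X, IsSDR P.M (P.nbhd r) T R) ∧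
      ((∃ C : Set X, P.IsSolution r C) →
        ∀ R : Set X, P.IsGreedyOutput r R → P.IsSolution (5 * r) R)) := by
  refine ⟨⟨OracleRAM.Center.main.compile, OracleRAM.Center.main.cost,
    fun X _ _ P r e => ?_⟩, fun X _ _ P r => ⟨fun i T U hi h => h.exists_choice hi,
    fun T U h => h.relaxIndep, fun hsol R hR => hR.isSolution hsol⟩⟩
  obtain ⟨k, hk, hexec⟩ := OracleRAM.Center.main.exec_compile (O := P.oracle e)
    (Fintype.card X) (P.input r e) rfl rfl (OracleRAM.Center.holds_input P r e).size
  have hout := OracleRAM.Center.run_main P r e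
  exact ⟨_, k, hexec, hk, hout, hout.isSolution⟩
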